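/- For each integer $N\ge1$ let $\Lambda_N=\mathbb Z/N\mathbb Z$, $\Omega_N=\{0,1\}^{\Lambda_N}$, and let $(\eta^N_t)_{t\ge0}$ be a continuous-time Markov process on $\Omega_N$ with generator $\mathcal L^N$. Write $\eta^{x,y}$ for $\eta$ with the values at $x,y$ exchanged and $\tau_x\eta=\eta_{\cdot+x}$. Let $I\subset\mathbb R$ and, for $\rho\in I$, let $\nu^N_\rho$ be probability measures on $\Omega_N$; put $\rho_N=E_{\nu_\rho^N}[\eta_0]$, $\bar\eta_x=\eta_x-\rho_N$. All $O(\cdot)$ and $\lesssim$ below are uniform in $N$, in the sites and in $\eta$ (constants may depend on $\rho$). Let $\alpha,\beta\in\mathbb R$ and assume: * (Assumption 1) For each $\rho\in I$, $\nu^N_\rho$ is stationary for $\mathcal L^N$ and translation invariant, and there are integers $m_1\ge0$, $m_2\ge1$ and constants $c_\Theta$ independent of $N$ such that for all $x\in\Lambda_N$ and all $\eta$ with $\nu_\rho^N(\eta)>0$ $$\frac{\nu^N_\rho(\eta^{x,x+1})}{\nu^N_\rho(\eta)}=1+N^{-\alpha}\sum_{\Theta\subset\{-m_1,\dots,m_2\}}c_\Theta\prod_{j\in\Theta}\bar\eta_{x+j}+O(N^{-2\alpha}).$$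 * (Assumption 2) For each $\rho\in I$ and each $m\ge2$, $\big|E_{\nu^N_\rho}[\prod_{j=1}^m\bar\eta_{x_j}]\big|\lesssim N^{-\beta}$ for all pairwise distinct $x_1,\dots,x_m\in\Lambda_N$, with a constant that may depend on $m$. * (Assumption 3) There are $\delta>0$ and functions $q^N_{0,1}:\Omega_N\to[\delta,1/\delta]$ such that for all $\rho\in I$, $N\ge 1$ and $f:\Omega_N\to\mathbb R$, $-\int f\mathcal L^Nf\,d\nu^N_\rho=\sum_{x\in\Lambda_N}\int q^N_{0,1}(\tau_x\eta)[f(\eta^{x,x+1})-f(\eta)]^2\,d\nu^N_\rho(\eta)$. For an integer $L\ge 1$ let $\overleftarrow\eta^{L}_x=\frac1L\sum_{y=x-L}^{x-1}\bar\eta_y$ and $\overrightarrow\eta^{L}_x=\frac1L\sum_{y=x+1}^{x+L}\bar\eta_y$; for real $L$ the superscript $L$ means $\lfloor L\rfloor$. Let $\rho\in I$, let $\mathbb E_{\nu^N_\rho}$ be the expectation for the (càdlàg) process $\eta^N$ started from $\nu^N_\rho$, let $t>0$, and let $G:\mathbb R/\mathbb Z\to\mathbb R$ satisfy $\sup_{N}\frac1N\sum_{x\in\Lambda_N}G(x/N)^2<\infty$.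 Consider the diffusive time scale ($a=2$). (i) If $\alpha\ge\frac32$ and $\beta\ge1$, then $$\lim_{\varepsilon\downarrow0}\limsup_{N\to\infty}\mathbb E_{\nu^N_\rho}\Big[\Big(\int_0^t\sum_{x\in\Lambda_N}G(\tfrac xN)\big\{\bar\eta_{sN^2}(x)\bar\eta_{sN^2}(x+1)-\overleftarrow\eta^{\varepsilon N}_{sN^2}(x)\,\overrightarrow\eta^{\varepsilon N}_{sN^2}(x)\big\}\,ds\Big)^2\Big]=0.$$ (ii) The same conclusion holds if $\alpha\ge\frac43$, $\beta\ge1$ and $2\alpha+\beta\ge4$, provided that in addition (Assumption 1a) for each $\rho\in I$ there are integers $m_1\ge0$, $m_2\ge1$ and coefficients $c'_{N,\Theta}$, bounded uniformly in $N$ and $\Theta$, with vanishing constant term $c'_{N,\varnothing}=0$, such that for all $x\in\Lambda_N$ and all $\eta$ with $\nu_\rho^N(\eta)>0$ $$\Big[\frac{\nu^N_\rho(\eta^{x,x+1})}{\nu^N_\rho(\eta)}-1\Big](\bar\eta_x-\bar\eta_{x+1})=N^{-\alpha}\sum_{\Theta\subset\{-m_1,\dots,m_2\}}c'_{N,\Theta}\prod_{j\in\Theta}\bar\eta_{x+j}+O(N^{-2\alpha}).$$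 -/

import Mathlib

open MeasureTheory Filter Topology Set
open scoped ENNReal NNReal

noncomputable section

namespace BoltzmannGibbs

/-- The state space `{0, 1} ^ 𝕋_N`, where the discrete torus `𝕋_N` is `ZMod N`. -/
abbrev Config (N : ℕ) : Type := ZMod N → Fin 2

/-- The occupation variable `η_x`, as a real number. -/
def occ {N : ℕ} (η : Config N) (x : ZMod N) : ℝ := ((η x : ℕ) : ℝ)

/-- The configuration `η^{x,y}` in which the states of `x` and `y` have been exchanged. -/
def swapConf {N : ℕ} (x y : ZMod N) (η : Config N) : Config N := fun z => η (Equiv.swap x y z)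

/-- The translation `τ_x η = η_{· + x}`. -/
def shift {N : ℕ} (x : ZMod N) (η : Config N) : Config N := fun z => η (z + x)

/-- A continuous-time exclusion-type dynamics on `{0, 1} ^ 𝕋_N` for every `N ≥ 1` (in its original,
non-accelerated time scale), together with a family of measures indexed by a set `I` of reals.
`rate N η ξ` is the rate of jumping from `η` to `ξ`. The measures `ν ρ N` are only relevant for
`ρ ∈ I`. -/
structure ParticleSystem where
  I : Set ℝ
  rate : (N : ℕ+) → Config N → Config N → ℝ≥0
  ν : ℝ → (N : ℕ+) → Measure (Config N)

namespace ParticleSystem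

variable (S : ParticleSystem)

/-- The Markov generator `(ℒ^N f)(η) = ∑_ξ rate(η, ξ) (f(ξ) - f(η))`. -/
def gen (N : ℕ+) (f : Config N → ℝ) (η : Config N) : ℝ :=
  ∑ ξ : Config N, (S.rate N η ξ : ℝ) * (f ξ - f η)

/-- The matrix of the generator: `(ℒ^N f)(η) = ∑_ξ genMatrix η ξ * f ξ`. -/
def genMatrix (N : ℕ+) : Matrix (Config N) (Config N) ℝ :=
  fun η ξ => S.gen N (Pi.single ξ 1) η

/-- The transition probabilities `p_t(η, ξ) = exp(t ℒ^N)(η, ξ)`. -/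
def transition (N : ℕ+) (t : ℝ) : Matrix (Config N) (Config N) ℝ :=
  NormedSpace.exp (t • S.genMatrix N)

/-- The Dirichlet form `𝒟_N(f, μ) = - ∫ f ℒ^N f dμ`. -/
def dirichlet (N : ℕ+) (f : Config N → ℝ) (μ : Measure (Config N)) : ℝ :=
  - ∫ η, f η * S.gen N f η ∂μ

/-- `μ` is stationary for the dynamics on `𝕋_N`: `∫ ℒ^N f dμ = 0` for every `f`. -/
def IsStationary (N : ℕ+) (μ : Measure (Config N)) : Prop :=
  ∀ f : Config N → ℝ, ∫ η, S.gen N f η ∂μ = 0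

end ParticleSystem

/-- `μ` is invariant by translation. -/
def IsTranslationInvariant {N : ℕ} (μ : Measure (Config N)) : Prop :=
  ∀ x : ZMod N, μ.map (shift x) = μ

/-- The density `ρ_N = E_μ[η_0]` (equal to `E_μ[η_x]` for each `x` if `μ` is translation
invariant). -/
def density {N : ℕ} (μ : Measure (Config N)) : ℝ := ∫ η, occ η 0 ∂μ

/-- The centred occupation variable `η_x - ρ_N`. -/
def cent {N : ℕ} (μ : Measure (Config N)) (η : Config N) (x : ZMod N) : ℝ :=
  occ η x - density μ

/-- The local polynomial `∑_Θ c_Θ ∏_{j ∈ Θ} (η_{x+j} - ρ_N)`, where `Θ` ranges over the subsets of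
`{-m₁, …, m₂}`. -/
def localPoly {N : ℕ} (μ : Measure (Config N)) (m₁ m₂ : ℕ) (c : Finset ℤ → ℝ)
    (η : Config N) (x : ZMod N) : ℝ :=
  ∑ Θ ∈ (Finset.Icc (-(m₁ : ℤ)) (m₂ : ℤ)).powerset, c Θ * ∏ j ∈ Θ, cent μ η (x + (j : ZMod N))

/-- The ratio `μ(η^{x,x+1}) / μ(η)`. -/
def swapRatio {N : ℕ} (μ : Measure (Config N)) (η : Config N) (x : ZMod N) : ℝ :=
  μ.real {swapConf x (x + 1) η} / μ.real {η}

/-- The measures `ν ρ N`, `ρ ∈ I`, are stationary and translation invariant probability measures,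
and they are invariant under nearest-neighbour swaps up to a local polynomial correction of order
`N^{-α}`, up to an error of order `N^{-2α}`. The ratio is considered at the configurations of
positive probability. -/
def NearlySwapInvariant (S : ParticleSystem) (α : ℝ) : Prop :=
  ∀ ρ ∈ S.I,
    (∀ N : ℕ+, IsProbabilityMeasure (S.ν ρ N) ∧ S.IsStationary N (S.ν ρ N) ∧
      IsTranslationInvariant (S.ν ρ N)) ∧
    ∃ (m₁ m₂ : ℕ) (c : Finset ℤ → ℝ) (K : ℝ), 1 ≤ m₂ ∧
      ∀ (N : ℕ+) (x : ZMod N) (η : Config N), (S.ν ρ N).real {η} ≠ 0 →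
        |swapRatio (S.ν ρ N) η x
            - (1 + (N : ℝ) ^ (-α) * localPoly (S.ν ρ N) m₁ m₂ c η x)|
          ≤ K * (N : ℝ) ^ (-(2 * α))

/-- The product `[ν(η^{x,x+1}) / ν(η) - 1] (η_x - η_{x+1})` of the swap correction with the discrete
gradient is, up to an error of order `N^{-2α}`, equal to `N^{-α}` times a local polynomial without
constant term in the centred variables. The coefficients may depend on `N` (through `ρ_N`), but
they are bounded. -/
def NoConstantTerm (S : ParticleSystem) (α : ℝ) : Prop :=
  ∀ ρ ∈ S.I, ∃ (m₁ m₂ : ℕ) (c : ℕ+ → Finset ℤ → ℝ) (K : ℝ), 1 ≤ m₂ ∧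
    (∀ N, c N ∅ = 0) ∧ (∀ N Θ, |c N Θ| ≤ K) ∧
    ∀ (N : ℕ+) (x : ZMod N) (η : Config N), (S.ν ρ N).real {η} ≠ 0 →
      |(swapRatio (S.ν ρ N) η x - 1) * (cent (S.ν ρ N) η x - cent (S.ν ρ N) η (x + 1))
          - (N : ℝ) ^ (-α) * localPoly (S.ν ρ N) m₁ m₂ (c N) η x|
        ≤ K * (N : ℝ) ^ (-(2 * α))

/-- For every `m ≥ 2` the `m`-point correlation functions are of order at most `N^{-β}`. -/
def CorrelationDecay (S : ParticleSystem) (β : ℝ) : Prop :=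
  ∀ ρ ∈ S.I, ∀ m : ℕ, 2 ≤ m → ∃ C : ℝ, ∀ (N : ℕ+) (x : Fin m → ZMod N), Function.Injective x →
    |∫ η, ∏ j, cent (S.ν ρ N) η (x j) ∂(S.ν ρ N)| ≤ C * (N : ℝ) ^ (-β)

/-- The Dirichlet form is a sum over nearest-neighbour swaps, with weights
`q_{x,x+1}(η) = q_{0,1}(τ_x η)` bounded from above and below uniformly in `N`. -/
def SwapDirichletForm (S : ParticleSystem) : Prop :=
  ∃ (δ : ℝ) (q : (N : ℕ+) → Config N → ℝ), 0 < δ ∧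
    (∀ (N : ℕ+) (η : Config N), q N η ∈ Icc δ (1 / δ)) ∧
    ∀ ρ ∈ S.I, ∀ (N : ℕ+) (f : Config N → ℝ),
      S.dirichlet N f (S.ν ρ N) =
        ∑ x : ZMod N, ∫ η, q N (shift x η) * (f (swapConf x (x + 1) η) - f η) ^ 2 ∂(S.ν ρ N)

/-- `X` is a càdlàg realisation on the probability space `(Ω, P)` of the Markov process with
generator `ℒ^N` (in the original time scale) and initial distribution `μ`. Times are reals, and only
nonnegative times matter. -/
structure IsMarkovProcess (S : ParticleSystem) (N : ℕ+) (μ : Measure (Config N))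
    {Ω : Type*} [MeasurableSpace Ω] (P : Measure Ω) (X : ℝ → Ω → Config N) : Prop where
  isProbabilityMeasure : IsProbabilityMeasure P
  measurable : ∀ t, 0 ≤ t → Measurable (X t)
  right_continuous : ∀ ω t, 0 ≤ t → ContinuousWithinAt (fun s => X s ω) (Ici t) t
  left_limits : ∀ ω t, 0 < t → ∃ ξ, Tendsto (fun s => X s ω) (𝓝[<] t) (𝓝 ξ)
  finite_dim : ∀ (n : ℕ) (s : Fin (n + 1) → ℝ) (ξ : Fin (n + 1) → Config N),
    s 0 = 0 → Monotone s →
      P.real {ω | ∀ i, X (s i) ω = ξ i} =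
        μ.real {ξ 0} *
          ∏ i : Fin n, S.transition N (s i.succ - s i.castSucc) (ξ i.castSucc) (ξ i.succ)

/-- The average of the centred variables over the box `{x - L, …, x - 1}`. -/
def leftAvg {N : ℕ} (μ : Measure (Config N)) (L : ℕ) (η : Config N) (x : ZMod N) : ℝ :=
  (1 / (L : ℝ)) * ∑ y ∈ Finset.Icc 1 L, cent μ η (x - (y : ZMod N))

/-- The average of the centred variables over the box `{x + 1, …, x + L}`. -/
def rightAvg {N : ℕ} (μ : Measure (Config N)) (L : ℕ) (η : Config N) (x : ZMod N) : ℝ :=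
  (1 / (L : ℝ)) * ∑ y ∈ Finset.Icc 1 L, cent μ η (x + (y : ZMod N))

/-- The point `x / N` of the continuous torus `ℝ / ℤ`. -/
def toCircle {N : ℕ} (x : ZMod N) : UnitAddCircle := (((x.val : ℝ) / (N : ℝ) : ℝ) : UnitAddCircle)

/-- `‖G‖²_{2,N} = N⁻¹ ∑_x G(x/N)²`. -/
def normSqN (G : UnitAddCircle → ℝ) (N : ℕ+) : ℝ :=
  (1 / (N : ℝ)) * ∑ x : ZMod N, G (toCircle x) ^ 2

/-- The field `∑_x G(x/N) {η̄_x η̄_{x+1} - (left average)_x (right average)_x}` with boxes of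
size `L`. -/
def field {N : ℕ+} (μ : Measure (Config N)) (G : UnitAddCircle → ℝ) (L : ℕ) (η : Config N) : ℝ :=
  ∑ x : ZMod N, G (toCircle x) *
    (cent μ η x * cent μ η (x + 1) - leftAvg μ L η x * rightAvg μ L η x)

/-- `E[(∫_0^t field(η_{s N²}) ds)²]` with boxes of size `⌊ε N⌋`, in the time scale `N²`. -/
def replacementError {N : ℕ+} (μ : Measure (Config N)) {Ω : Type*} [MeasurableSpace Ω]
    (P : Measure Ω) (X : ℝ → Ω → Config N) (G : UnitAddCircle → ℝ) (t ε : ℝ) : ℝ≥0∞ :=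
  ∫⁻ ω, ENNReal.ofReal
    ((∫ s in (0 : ℝ)..t, field μ G ⌊ε * (N : ℝ)⌋₊ (X (s * (N : ℝ) ^ 2) ω)) ^ 2) ∂P

end BoltzmannGibbs

end

/-!
The field in the theorem is the sum of `∑_x G_x η̄_x (η̄_{x+1} - →η_x)` and of the average over
`a ∈ {1, …, L}` of `∑_x G_x η̄_{x+a} (η̄_x - ←η_x)`. After Abel summation and a translation of `x`,
each of these fields has the form `gradField`,
`∑_x v_x η̄_x ∑_k W_k (η_{x+k} - η_{x+k+1})` with `|W_k| ≤ 1` and at most `L` nonzero weights, none of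
them attached to a bond that contains `x` (`field_eq`). Hence it suffices to show that the second
moment of the time integral of such a field is of order `(N⁻¹ ∑_x v_x²) (L / N + N^{-2/3})`
(`exists_timeMoment_gradField_le`). With `L = ⌊ε N⌋` the replacement error is then of order `ε`; no
induction over scales is necessary, because the sum over `x` is never estimated term by term.

Exchanging the states of `z` and `z + 1` changes the sign of `η_z - η_{z+1}`. Together with the
nearly invariant law `ν` this gives an integration by parts formula (`integral_mul_grad`), which
splits the field into two parts.

* The first part pairs with a test function `f` only through the differences
  `f(η^{z,z+1}) - f(η)`. For fixed `z` the coefficient of the bond `{z, z + 1}` is a linear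
  combination of centred variables, whose variance is of the order of the sum of the squared
  coefficients, since the two-point correlations are at most of order `1 / N`
  (`CorrBound.integral_sq_linear_le`). This bounds the `H_{-1}` norm
  (`CorrBound.two_mul_integral_sub_le`), and the Kipnis–Varadhan inequality
  (`IsMarkovProcess.integral_sq_integral_le`) applies. The latter holds without reversibility: for
  `g_s = ∫_0^s P_u f du` the derivative of `‖g_s‖² / 2` is `⟨f, g_s⟩ - 𝒟(g_s)`.
* The second part, `drift`, carries the factor `ν(η^{z,z+1}) / ν(η) - 1`, and its static second
  moment is already small. It is a sum of terms `η̄_x ∏_{j ∈ Θ} η̄_{x+k+j}` times `N^{-α}`. In the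
  Gram matrix, a product of two such terms has a mean of order `N^{-β}` as soon as some site occurs
  in it exactly once (`CorrBound.abs_integral_quad_le`); for nonempty `Θ` and fixed `x` the
  exceptions form a set of size `O(N)` (`exists_covering_triples`), and Schur's test
  (`integral_sq_sum_le`) concludes. Only the constant term, `Θ = ∅`, needs `α ≥ 3 / 2`.

The constant term is absent in the second statement by assumption. In the first statement the local
polynomial is the product of the one in the expansion of `ν(η^{z,z+1}) / ν(η)` with the gradient
(`exists_localPoly_mul_grad`).
-/

/-! ### The semigroup of the dynamics -/

namespace BoltzmannGibbs

/-- On the finite space of configurations every integral is a weighted sum. -/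
theorem integral_config {N : ℕ} [NeZero N] (μ : Measure (Config N)) [IsFiniteMeasure μ]
    (f : Config N → ℝ) : ∫ η, f η ∂μ = ∑ η, μ.real {η} * f η := by
  rw [integral_fintype (Integrable.of_finite)]
  simp

namespace ParticleSystem

variable (S : ParticleSystem)

theorem genMatrix_mulVec (N : ℕ+) (f : Config N → ℝ) :
    (S.genMatrix N).mulVec f = S.gen N f := by
  funext η
  simp only [Matrix.mulVec, dotProduct, genMatrix, gen, Finset.sum_mul]
  rw [Finset.sum_comm]
  refine Finset.sum_congr rfl fun ζ _ => ?_
  simp only [mul_assoc, ← Finset.mul_sum, sub_mul, Finset.sum_sub_distrib]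
  simp [Pi.single_apply]

/-- The semigroup `P_t f = exp(t ℒ^N) f`. -/
noncomputable def semigroup (N : ℕ+) (t : ℝ) (f : Config N → ℝ) : Config N → ℝ :=
  (S.transition N t).mulVec f

theorem semigroup_apply (N : ℕ+) (t : ℝ) (f : Config N → ℝ) (η : Config N) :
    S.semigroup N t f η = ∑ ξ, S.transition N t η ξ * f ξ := rfl

theorem semigroup_zero (N : ℕ+) (f : Config N → ℝ) : S.semigroup N 0 f = f := by
  simp [semigroup, transition, NormedSpace.exp_zero]

section
attribute [local instance] Matrix.linftyOpNormedRing Matrix.linftyOpNormedAlgebra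

/-- The backward equation `∂_t P_t f = ℒ^N P_t f`. -/
theorem hasDerivAt_semigroup (N : ℕ+) (f : Config N → ℝ) (η : Config N) (t : ℝ) :
    HasDerivAt (fun s => S.semigroup N s f η) (S.gen N (S.semigroup N t f) η) t := by
  have h := hasDerivAt_exp_smul_const' (𝕂 := ℝ) (S.genMatrix N) t
  let ℓ : Matrix (Config N) (Config N) ℝ →ₗ[ℝ] ℝ :=
    { toFun := fun A => A.mulVec f η
      map_add' := fun A B => by simp [Matrix.add_mulVec]
      map_smul' := fun c A => by simp [Matrix.smul_mulVec] }
  have h2 := (LinearMap.toContinuousLinearMap ℓ).hasFDerivAt.comp_hasDerivAt t h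
  rw [← genMatrix_mulVec, semigroup, Matrix.mulVec_mulVec]
  exact h2

end

theorem continuous_semigroup (N : ℕ+) (f : Config N → ℝ) (η : Config N) :
    Continuous fun s => S.semigroup N s f η :=
  continuous_iff_continuousAt.2 fun t => (S.hasDerivAt_semigroup N f η t).continuousAt

theorem sum_semigroup_of_isStationary {N : ℕ+} {μ : Measure (Config N)} [IsFiniteMeasure μ]
    (hμ : S.IsStationary N μ) (f : Config N → ℝ) (t : ℝ) :
    ∑ η, μ.real {η} * S.semigroup N t f η = ∑ η, μ.real {η} * f η := by
  have hd : ∀ s, HasDerivAt (fun s => ∑ η, μ.real {η} * S.semigroup N s f η) 0 s := by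
    intro s
    have h := HasDerivAt.fun_sum (u := Finset.univ) fun (η : Config N) _ =>
      (S.hasDerivAt_semigroup N f η s).const_mul (μ.real {η})
    have h0 := hμ (S.semigroup N s f)
    rw [integral_config] at h0
    rwa [h0] at h
  have := is_const_of_deriv_eq_zero (fun s => (hd s).differentiableAt) (fun s => (hd s).deriv) t 0
  simpa [semigroup_zero] using this

/-- The time integral `∫_0^s P_u f du`. -/
noncomputable def potential (N : ℕ+) (s : ℝ) (f : Config N → ℝ) : Config N → ℝ :=
  fun η => ∫ u in (0 : ℝ)..s, S.semigroup N u f η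

theorem hasDerivAt_potential (N : ℕ+) (f : Config N → ℝ) (η : Config N) (s : ℝ) :
    HasDerivAt (fun s => S.potential N s f η) (S.semigroup N s f η) s :=
  ((S.continuous_semigroup N f η).integral_hasStrictDerivAt 0 s).hasDerivAt

theorem continuous_potential (N : ℕ+) (f : Config N → ℝ) (η : Config N) :
    Continuous fun s => S.potential N s f η :=
  continuous_iff_continuousAt.2 fun t => (S.hasDerivAt_potential N f η t).continuousAt

theorem semigroup_eq_add_gen_potential (N : ℕ+) (f : Config N → ℝ) (η : Config N) (s : ℝ) :
    S.semigroup N s f η = f η + S.gen N (S.potential N s f) η := by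
  have hc : Continuous fun u => S.gen N (S.semigroup N u f) η := by
    unfold gen
    exact continuous_finsetSum _ fun ξ _ => continuous_const.mul
      ((S.continuous_semigroup N f ξ).sub (S.continuous_semigroup N f η))
  have h := intervalIntegral.integral_eq_sub_of_hasDerivAt (a := 0) (b := s)
    (fun u _ => S.hasDerivAt_semigroup N f η u) (hc.intervalIntegrable _ _)
  have h2 : ∫ u in (0 : ℝ)..s, S.gen N (S.semigroup N u f) η = S.gen N (S.potential N s f) η := by
    unfold gen potential
    rw [intervalIntegral.integral_finsetSum]
    · refine Finset.sum_congr rfl fun ξ _ => ?_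
      rw [intervalIntegral.integral_const_mul, intervalIntegral.integral_sub]
      · exact (S.continuous_semigroup N f ξ).intervalIntegrable _ _
      · exact (S.continuous_semigroup N f η).intervalIntegrable _ _
    · intro ξ _
      exact (continuous_const.mul
        ((S.continuous_semigroup N f ξ).sub (S.continuous_semigroup N f η))).intervalIntegrable _ _
  rw [← h2, h, semigroup_zero]
  ring

/-- The `H_{-1}` estimate at the level of the semigroup. With `g_s = ∫_0^s P_u f du` one has
`∂_s ‖g_s‖² / 2 = ⟨f, g_s⟩ - 𝒟(g_s)`, and the variational bound turns the Dirichlet form into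
`2 ⟨f, g_s⟩ - A`. No reversibility is involved. -/
theorem integral_potential_le {N : ℕ+} {μ : Measure (Config N)} [IsFiniteMeasure μ]
    {f : Config N → ℝ} {A : ℝ}
    (hA : ∀ g : Config N → ℝ, 2 * ∑ η, μ.real {η} * (f η * g η) - S.dirichlet N g μ ≤ A)
    {T : ℝ} (hT : 0 ≤ T) :
    ∫ s in (0 : ℝ)..T, ∑ η, μ.real {η} * (f η * S.potential N s f η) ≤ T * A := by
  set b : ℝ → ℝ := fun s => ∑ η, μ.real {η} * (f η * S.potential N s f η) with hb
  have hbc : Continuous b := continuous_finsetSum _ fun η _ =>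
    continuous_const.mul (continuous_const.mul (S.continuous_potential N f η))
  let Φ : ℝ → ℝ := fun s =>
    s * A - (∫ u in (0 : ℝ)..s, b u) - (1 / 2) * ∑ η, μ.real {η} * S.potential N s f η ^ 2
  let Φ' : ℝ → ℝ := fun s =>
    1 * A - b s -
      (1 / 2) * ∑ η, μ.real {η} * (2 * S.potential N s f η ^ 1 * S.semigroup N s f η)
  have hΦ : ∀ s, HasDerivAt Φ (Φ' s) s := fun s =>
    (((hasDerivAt_id s).mul_const A).sub (hbc.integral_hasStrictDerivAt 0 s).hasDerivAt).sub
      ((HasDerivAt.fun_sum fun η _ =>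
        ((S.hasDerivAt_potential N f η s).fun_pow 2).const_mul _).const_mul _)
  have hpos : ∀ s, 0 ≤ Φ' s := by
    intro s
    have h := hA (S.potential N s f)
    rw [dirichlet, integral_config] at h
    have h2 : (1 / 2) * ∑ η, μ.real {η} * (2 * S.potential N s f η ^ 1 * S.semigroup N s f η) =
        b s + ∑ η, μ.real {η} * (S.potential N s f η * S.gen N (S.potential N s f) η) := by
      rw [hb, ← Finset.sum_add_distrib, Finset.mul_sum]
      refine Finset.sum_congr rfl fun η _ => ?_
      rw [semigroup_eq_add_gen_potential]
      ring
    simp only [Φ', h2]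
    linarith
  have hmono : Monotone Φ :=
    monotone_of_deriv_nonneg (fun s => (hΦ s).differentiableAt) fun s => by
      rw [(hΦ s).deriv]; exact hpos s
  have h0 : Φ 0 = 0 := by simp [Φ, potential]
  have h1 := hmono hT
  rw [h0] at h1
  have h2 : 0 ≤ ∑ η, μ.real {η} * S.potential N T f η ^ 2 :=
    Finset.sum_nonneg fun η _ => by positivity
  simp only [Φ] at h1
  linarith

end ParticleSystem
end BoltzmannGibbs

/-! ### Second moments of additive functionals -/

namespace BoltzmannGibbs

theorem exists_norm_le {N : ℕ+} (f : Config N → ℝ) : ∃ C, ∀ η, ‖f η‖ ≤ C := by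
  obtain ⟨C, hC⟩ := (Set.finite_range fun η => ‖f η‖).bddAbove
  exact ⟨C, fun η => hC ⟨η, rfl⟩⟩

namespace IsMarkovProcess

variable {S : ParticleSystem} {N : ℕ+} {μ : Measure (Config N)} {Ω : Type*} [MeasurableSpace Ω]
  {P : Measure Ω} {X : ℝ → Ω → Config N}

/-- Joint measurability of `(s, ω) ↦ f(X_s(ω))`, by approximating `s` from the right by the points
of the lattices `ℕ / (n + 1)`. Negative times are sent to `0`. -/
theorem measurable_uncurry (h : IsMarkovProcess S N μ P X) (f : Config N → ℝ) :
    Measurable fun z : ℝ × Ω => f (X (max z.1 0) z.2) := by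
  let r : ℕ → ℝ → ℝ := fun n s => ((⌊((n : ℝ) + 1) * max s 0⌋₊ : ℝ) + 1) / ((n : ℝ) + 1)
  have hr : ∀ n s, max s 0 ≤ r n s ∧ r n s ≤ max s 0 + 1 / ((n : ℝ) + 1) := by
    intro n s
    have hn : (0 : ℝ) < (n : ℝ) + 1 := by positivity
    have h0 : 0 ≤ ((n : ℝ) + 1) * max s 0 := by positivity
    constructor
    · rw [le_div_iff₀ hn, mul_comm]
      exact (Nat.lt_floor_add_one _).le
    · have e : (max s 0 + 1 / ((n : ℝ) + 1)) * ((n : ℝ) + 1) = ((n : ℝ) + 1) * max s 0 + 1 := by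
        field_simp
      rw [div_le_iff₀ hn, e]
      linarith [Nat.floor_le h0]
  refine measurable_of_tendsto_metrizable
    (f := fun n (z : ℝ × Ω) => f (X (r n z.1) z.2)) (fun n => ?_) ?_
  · have h1 : Measurable fun w : ℕ × Ω => f (X (((w.1 : ℝ) + 1) / ((n : ℝ) + 1)) w.2) :=
      measurable_from_prod_countable_right fun k =>
        (measurable_of_finite f).comp 
          (h.measurable (((k : ℝ) + 1) / ((n : ℝ) + 1)) (by positivity))
    have h2 : Measurable fun z : ℝ × Ω => (⌊((n : ℝ) + 1) * max z.1 0⌋₊, z.2) :=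
      ((Nat.measurable_floor.comp ((measurable_fst.max measurable_const).const_mul _))).prodMk
        measurable_snd
    exact h1.comp h2
  · rw [tendsto_pi_nhds]
    rintro ⟨s, ω⟩
    have hc := h.right_continuous ω (max s 0) (le_max_right _ _)
    have hf : Continuous f := continuous_of_discreteTopology
    refine (hf.tendsto _).comp (hc.tendsto.comp ?_)
    rw [tendsto_nhdsWithin_iff]
    refine ⟨?_, Eventually.of_forall fun n => (hr n s).1⟩
    refine tendsto_of_tendsto_of_tendsto_of_le_of_le tendsto_const_nhds ?_
      (fun n => (hr n s).1) (fun n => (hr n s).2)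
    simpa using tendsto_one_div_add_atTop_nhds_zero_nat.const_add (max s 0)

/-- Two-time correlations of the stationary process. -/
theorem integral_mul (h : IsMarkovProcess S N μ P X) [IsProbabilityMeasure μ]
    (hμ : S.IsStationary N μ) (f g : Config N → ℝ) {s r : ℝ} (hs : 0 ≤ s) (hr : s ≤ r) :
    ∫ ω, f (X s ω) * g (X r ω) ∂P =
      ∑ η, μ.real {η} * (f η * S.semigroup N (r - s) g η) := by
  have := h.isProbabilityMeasure
  let Z : Ω → Config N × Config N × Config N := fun ω => (X 0 ω, X s ω, X r ω)
  have hZ : Measurable Z :=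
    (h.measurable 0 le_rfl).prodMk ((h.measurable s hs).prodMk (h.measurable r (hs.trans hr)))
  have hint : ∫ ω, f (X s ω) * g (X r ω) ∂P = ∫ z, f z.2.1 * g z.2.2 ∂(P.map Z) := by
    rw [integral_map hZ.aemeasurable (measurable_of_finite _).aestronglyMeasurable]
  have : IsProbabilityMeasure (P.map Z) := Measure.isProbabilityMeasure_map hZ.aemeasurable
  have hw : ∀ a b c, (P.map Z).real {(a, b, c)} =
      μ.real {a} * (S.transition N s a b * S.transition N (r - s) b c) := by
    intro a b c
    rw [map_measureReal_apply hZ (measurableSet_singleton _)]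
    have hm : Monotone ![0, s, r] := by
      refine Fin.monotone_iff_le_succ.2 fun i => ?_
      fin_cases i
      · simpa using hs
      · simpa using hr
    have := h.finite_dim 2 ![0, s, r] ![a, b, c] rfl hm
    simp only [Fin.forall_fin_succ, Fin.prod_univ_two] at this
    simp at this
    rw [← this]
    congr 1
    ext ω
    simp [Z]
  rw [hint, integral_fintype Integrable.of_finite]
  simp only [Fintype.sum_prod_type, hw, smul_eq_mul]
  rw [← S.sum_semigroup_of_isStationary hμ (fun η => f η * S.semigroup N (r - s) g η) s]
  refine Finset.sum_congr rfl fun a _ => ?_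
  rw [S.semigroup_apply, Finset.mul_sum]
  refine Finset.sum_congr rfl fun b _ => ?_
  rw [S.semigroup_apply]
  simp only [Finset.mul_sum]
  refine Finset.sum_congr rfl fun c _ => ?_
  ring

theorem integrable_bounded (h : IsMarkovProcess S N μ P X) (f : Config N → ℝ) {s : ℝ}
    (hs : 0 ≤ s) : Integrable (fun ω => f (X s ω)) P := by
  have := h.isProbabilityMeasure
  obtain ⟨C, hC⟩ := exists_norm_le f
  exact Integrable.of_bound ((measurable_of_finite f).comp (h.measurable s hs)).aestronglyMeasurable
    C (Eventually.of_forall fun ω => hC _)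

/-- Fubini's theorem for the second moment of `∫_0^T f(X_s) ds`. -/
theorem integral_sq_integral (h : IsMarkovProcess S N μ P X) (f : Config N → ℝ) {T : ℝ}
    (hT : 0 ≤ T) :
    ∫ ω, (∫ s in (0 : ℝ)..T, f (X s ω)) ^ 2 ∂P =
      ∫ s in (0 : ℝ)..T, ∫ r in (0 : ℝ)..T, ∫ ω, f (X s ω) * f (X r ω) ∂P := by
  have := h.isProbabilityMeasure
  obtain ⟨C, hC⟩ := exists_norm_le f
  set lam : Measure ℝ := volume.restrict (Ioc 0 T) with hlam
  let Y : ℝ → Ω → ℝ := fun s ω => f (X (max s 0) ω)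
  have hY : Measurable fun z : ℝ × Ω => Y z.1 z.2 := h.measurable_uncurry f
  have hYX : ∀ s ∈ Ioc 0 T, ∀ ω, f (X s ω) = Y s ω := fun s hs ω => by
    simp [Y, max_eq_left hs.1.le]
  have e1 : ∀ ω, (∫ s in (0 : ℝ)..T, f (X s ω)) ^ 2 = ∫ z, Y z.1 ω * Y z.2 ω ∂(lam.prod lam) := by
    intro ω
    rw [integral_prod_mul (fun s => Y s ω) (fun s => Y s ω), intervalIntegral.integral_of_le hT,
      setIntegral_congr_fun measurableSet_Ioc (fun s hs => hYX s hs ω), sq]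
  have hint : Integrable (fun p : Ω × (ℝ × ℝ) => Y p.2.1 p.1 * Y p.2.2 p.1)
      (P.prod (lam.prod lam)) := by
    refine Integrable.of_bound (C := C * C) ?_ (Eventually.of_forall fun p => ?_)
    · exact ((hY.comp (measurable_snd.fst.prodMk measurable_fst)).mul
        (hY.comp (measurable_snd.snd.prodMk measurable_fst))).aestronglyMeasurable
    · rw [norm_mul]
      exact mul_le_mul (hC _) (hC _) (norm_nonneg _) ((norm_nonneg _).trans (hC (X 0 p.1)))
  simp only [e1]
  rw [integral_integral_swap (f := fun ω (z : ℝ × ℝ) => Y z.1 ω * Y z.2 ω) hint,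
    integral_prod _ hint.integral_prod_right, intervalIntegral.integral_of_le hT]
  refine setIntegral_congr_fun measurableSet_Ioc fun s hs => ?_
  simp only
  rw [intervalIntegral.integral_of_le hT]
  refine setIntegral_congr_fun measurableSet_Ioc fun r hr => ?_
  simp only [hYX s hs, hYX r hr]

/-- The Kipnis–Varadhan inequality: the second moment of `∫_0^T f(X_s) ds` is at most `2 T` times
the squared `H_{-1}` norm of `f`, given in its variational form. -/
theorem integral_sq_integral_le (h : IsMarkovProcess S N μ P X) [IsProbabilityMeasure μ]
    (hμ : S.IsStationary N μ) {f : Config N → ℝ} {A : ℝ}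
    (hA : ∀ g : Config N → ℝ, 2 * ∫ η, f η * g η ∂μ - S.dirichlet N g μ ≤ A)
    {T : ℝ} (hT : 0 ≤ T) :
    ∫ ω, (∫ s in (0 : ℝ)..T, f (X s ω)) ^ 2 ∂P ≤ 2 * T * A := by
  simp only [integral_config μ] at hA
  set c : ℝ → ℝ := fun u => ∑ η, μ.real {η} * (f η * S.semigroup N u f η) with hc
  set C : ℝ → ℝ := fun s => ∑ η, μ.real {η} * (f η * S.potential N s f η) with hC
  have hcc : Continuous c := continuous_finsetSum _ fun η _ =>
    continuous_const.mul (continuous_const.mul (S.continuous_semigroup N f η))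
  have hCc : Continuous C := continuous_finsetSum _ fun η _ =>
    continuous_const.mul (continuous_const.mul (S.continuous_potential N f η))
  have hint : ∀ s, ∫ u in (0 : ℝ)..s, c u = C s := by
    intro s
    rw [hc, hC, intervalIntegral.integral_finsetSum]
    · refine Finset.sum_congr rfl fun η _ => ?_
      rw [intervalIntegral.integral_const_mul, intervalIntegral.integral_const_mul]
      rfl
    · intro η _
      exact (continuous_const.mul (continuous_const.mul
        (S.continuous_semigroup N f η))).intervalIntegrable _ _
  rw [h.integral_sq_integral f hT]
  have inner : ∀ s ∈ uIcc 0 T, ∫ r in (0 : ℝ)..T, ∫ ω, f (X s ω) * f (X r ω) ∂P =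
      C s + C (T - s) := by
    intro s hs
    rw [uIcc_of_le hT] at hs
    have e : ∫ r in (0 : ℝ)..T, ∫ ω, f (X s ω) * f (X r ω) ∂P =
        ∫ r in (0 : ℝ)..T, c |r - s| := by
      refine intervalIntegral.integral_congr fun r hr => ?_
      rw [uIcc_of_le hT] at hr
      rcases le_total s r with hsr | hsr
      · rw [h.integral_mul hμ f f hs.1 hsr, abs_of_nonneg (sub_nonneg.2 hsr)]
      · rw [abs_of_nonpos (sub_nonpos.2 hsr), neg_sub]
        simp only [mul_comm (f (X s _))]
        rw [h.integral_mul hμ f f hr.1 hsr]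
    have hac : Continuous fun r => c |r - s| := hcc.comp (continuous_abs.comp
      (continuous_id.sub continuous_const))
    rw [e, ← intervalIntegral.integral_add_adjacent_intervals (b := s)
      (hac.intervalIntegrable _ _) (hac.intervalIntegrable _ _)]
    congr 1
    · rw [← hint s]
      have : ∫ r in (0 : ℝ)..s, c |r - s| = ∫ r in (0 : ℝ)..s, c (s - r) := by
        refine intervalIntegral.integral_congr fun r hr => ?_
        rw [uIcc_of_le hs.1] at hr
        rw [abs_of_nonpos (sub_nonpos.2 hr.2), neg_sub]
      rw [this, intervalIntegral.integral_comp_sub_left]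
      simp
    · rw [← hint (T - s)]
      have : ∫ r in s..T, c |r - s| = ∫ r in s..T, c (r - s) := by
        refine intervalIntegral.integral_congr fun r hr => ?_
        rw [uIcc_of_le hs.2] at hr
        rw [abs_of_nonneg (sub_nonneg.2 hr.1)]
      rw [this, intervalIntegral.integral_comp_sub_right]
      simp
  have hCr : Continuous fun s => C (T - s) := hCc.comp (continuous_const.sub continuous_id)
  rw [intervalIntegral.integral_congr inner, intervalIntegral.integral_add
    (hCc.intervalIntegrable _ _) (hCr.intervalIntegrable _ _),
    intervalIntegral.integral_comp_sub_left]
  simp only [sub_self, sub_zero]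
  have := S.integral_potential_le hA hT
  linarith

/-- The crude bound by the static second moment. -/
theorem integral_sq_integral_le_sq (h : IsMarkovProcess S N μ P X) [IsProbabilityMeasure μ]
    (hμ : S.IsStationary N μ) (f : Config N → ℝ) {T : ℝ} (hT : 0 ≤ T) :
    ∫ ω, (∫ s in (0 : ℝ)..T, f (X s ω)) ^ 2 ∂P ≤ T ^ 2 * ∫ η, f η ^ 2 ∂μ := by
  have := h.isProbabilityMeasure
  rw [h.integral_sq_integral f hT, integral_config μ]
  set B := ∑ η, μ.real {η} * f η ^ 2 with hB
  have hsq : ∀ s, 0 ≤ s → ∫ ω, f (X s ω) ^ 2 ∂P = B := by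
    intro s hs
    have := h.integral_mul hμ f f hs le_rfl
    simp only [sub_self, S.semigroup_zero, ← sq] at this
    exact this
  have hpt : ∀ s, 0 ≤ s → ∀ r, 0 ≤ r → ‖∫ ω, f (X s ω) * f (X r ω) ∂P‖ ≤ B := by
    intro s hs r hr
    refine (norm_integral_le_integral_norm _).trans ?_
    calc ∫ ω, ‖f (X s ω) * f (X r ω)‖ ∂P
        ≤ ∫ ω, (1 / 2 * f (X s ω) ^ 2 + 1 / 2 * f (X r ω) ^ 2) ∂P := by
          refine integral_mono_of_nonneg (Eventually.of_forall fun ω => norm_nonneg _) ?_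
            (Eventually.of_forall fun ω => ?_)
          · exact ((h.integrable_bounded (fun η => f η ^ 2) hs).const_mul _).add
              ((h.integrable_bounded (fun η => f η ^ 2) hr).const_mul _)
          · simp only [Real.norm_eq_abs]
            rw [abs_le]
            constructor
            · nlinarith [sq_nonneg (f (X s ω) + f (X r ω))]
            · nlinarith [sq_nonneg (f (X s ω) - f (X r ω))]
      _ = B := by
          rw [integral_add ((h.integrable_bounded (fun η => f η ^ 2) hs).const_mul _)
            ((h.integrable_bounded (fun η => f η ^ 2) hr).const_mul _), integral_const_mul,
            integral_const_mul, hsq s hs, hsq r hr]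
          ring
  have hin : ∀ s ∈ uIoc 0 T, ‖∫ r in (0 : ℝ)..T, ∫ ω, f (X s ω) * f (X r ω) ∂P‖ ≤ B * |T - 0| := by
    intro s hs
    rw [uIoc_of_le hT] at hs
    refine intervalIntegral.norm_integral_le_of_norm_le_const fun r hr => ?_
    rw [uIoc_of_le hT] at hr
    exact hpt s hs.1.le r hr.1.le
  have := intervalIntegral.norm_integral_le_of_norm_le_const hin
  rw [sub_zero, abs_of_nonneg hT] at this
  calc _ ≤ _ := le_abs_self _
    _ ≤ _ := this
    _ = _ := by ring

end IsMarkovProcess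
end BoltzmannGibbs

/-! ### Static second moments under decay of correlations -/

namespace BoltzmannGibbs

theorem occ_nonneg {n : ℕ} (η : Config n) (x : ZMod n) : 0 ≤ occ η x := Nat.cast_nonneg _

theorem occ_le_one {n : ℕ} (η : Config n) (x : ZMod n) : occ η x ≤ 1 := by
  unfold occ
  exact_mod_cast Nat.lt_succ_iff.1 (η x).isLt

theorem density_nonneg {n : ℕ} (μ : Measure (Config n)) : 0 ≤ density μ :=
  integral_nonneg fun η => occ_nonneg η 0

/-- The correlations of at most `M` centred variables at distinct sites are at most `κ`. One-point
correlations are included. -/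
def CorrBound {n : ℕ} (μ : Measure (Config n)) (M : ℕ) (κ : ℝ) : Prop :=
  ∀ S : Finset (ZMod n), S.Nonempty → S.card ≤ M → |∫ η, ∏ x ∈ S, cent μ η x ∂μ| ≤ κ

theorem CorrBound.nonneg {n : ℕ} {μ : Measure (Config n)} {M : ℕ} {κ : ℝ}
    (h : CorrBound μ M κ) (hM : 1 ≤ M) : 0 ≤ κ :=
  (abs_nonneg _).trans (h {0} (Finset.singleton_nonempty _) (by simpa using hM))

theorem abs_integral_le_of_abs_le {n : ℕ} {μ : Measure (Config n)} [IsProbabilityMeasure μ]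
    {f : Config n → ℝ} {C : ℝ} (h : ∀ η, |f η| ≤ C) :
    |∫ η, f η ∂μ| ≤ C := by
  have := norm_integral_le_of_norm_le_const (μ := μ) (f := f) (C := C) (Eventually.of_forall h)
  simpa using this

variable {n : ℕ} [NeZero n] {μ : Measure (Config n)} [IsProbabilityMeasure μ]

variable (μ) in
theorem density_le_one : density μ ≤ 1 := by
  have : density μ ≤ ∫ _, (1 : ℝ) ∂μ :=
    integral_mono Integrable.of_finite Integrable.of_finite fun η => occ_le_one η 0
  simpa using this

theorem abs_cent_le (η : Config n) (x : ZMod n) : |cent μ η x| ≤ 1 := by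
  unfold cent
  rw [abs_le]
  constructor <;>
    linarith [occ_nonneg η x, occ_le_one η x, density_nonneg μ, density_le_one μ]

theorem abs_prod_cent_le (η : Config n) (S : Finset (ZMod n)) :
    |∏ x ∈ S, cent μ η x| ≤ 1 := by
  rw [Finset.abs_prod]
  exact Finset.prod_le_one (fun _ _ => abs_nonneg _) fun _ _ => abs_cent_le _ _

/-- A product of one-site functions, one of which is a centred variable, is as small in mean as the
correlations: each of the other factors is an affine function of the centred variable at its site,
and every term in the expansion of the product keeps the distinguished site. -/
theorem CorrBound.abs_integral_prod_le {M : ℕ} {κ : ℝ} (h : CorrBound μ M κ)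
    {U : Finset (ZMod n)} (hU : U.card ≤ M) {s₀ : ZMod n} (hs : s₀ ∈ U)
    (φ : ZMod n → Fin 2 → ℝ) (hφ : ∀ s v, |φ s v| ≤ 1)
    (hφ₀ : ∀ v : Fin 2, φ s₀ v = ((v : ℕ) : ℝ) - density μ) :
    |∫ η, ∏ s ∈ U, φ s (η s) ∂μ| ≤ 4 ^ M * κ := by
  have hκ : 0 ≤ κ := h.nonneg ((Finset.card_pos.2 ⟨s₀, hs⟩).trans_le hU)
  set θ := density μ with hθ
  have hθ0 : 0 ≤ θ := density_nonneg μ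
  have hθ1 : θ ≤ 1 := density_le_one μ
  set b : ZMod n → ℝ := fun s => φ s 1 - φ s 0 with hb
  set a : ZMod n → ℝ := fun s => (1 - θ) * φ s 0 + θ * φ s 1 with ha
  have hbb : ∀ s, |b s| ≤ 2 := fun s => by
    have h0 := abs_le.1 (hφ s 0)
    have h1 := abs_le.1 (hφ s 1)
    rw [abs_le]
    constructor <;> simp only [hb] <;> linarith [h0.1, h0.2, h1.1, h1.2]
  have haa : ∀ s, |a s| ≤ 1 := fun s => by
    have h0 := abs_le.1 (hφ s 0)
    have h1 := abs_le.1 (hφ s 1)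
    rw [abs_le]
    constructor <;> simp only [ha] <;> nlinarith [h0.1, h0.2, h1.1, h1.2]
  -- the distinguished factor has no constant part
  have ha0 : a s₀ = 0 := by simp only [ha, hφ₀]; simp; ring
  have hexp : ∀ η : Config n, ∏ s ∈ U, φ s (η s) =
      ∑ T ∈ U.powerset, ((∏ s ∈ T, b s) * ∏ s ∈ U \ T, a s) * ∏ s ∈ T, cent μ η s := by
    intro η
    have : ∀ s, φ s (η s) = b s * cent μ η s + a s := by
      intro s
      simp only [hb, ha, cent, occ, ← hθ]
      have : η s = 0 ∨ η s = 1 := by omega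
      rcases this with e | e <;> rw [e] <;> simp <;> ring
    simp only [this]
    rw [Finset.prod_add]
    refine Finset.sum_congr rfl fun T _ => ?_
    rw [Finset.prod_mul_distrib]
    ring
  simp only [hexp]
  rw [integral_finsetSum _ fun _ _ => Integrable.of_finite]
  refine (Finset.abs_sum_le_sum_abs _ _).trans ?_
  have hterm : ∀ T ∈ U.powerset,
      |∫ η, ((∏ s ∈ T, b s) * ∏ s ∈ U \ T, a s) * ∏ s ∈ T, cent μ η s ∂μ| ≤ 2 ^ M * κ := by
    intro T hT
    rw [Finset.mem_powerset] at hT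
    have hTM : T.card ≤ M := (Finset.card_le_card hT).trans hU
    rw [integral_const_mul, abs_mul, abs_mul]
    by_cases hsT : s₀ ∈ T
    · have e1 : |∏ s ∈ T, b s| ≤ 2 ^ M := by
        rw [Finset.abs_prod]
        refine (Finset.prod_le_prod (fun _ _ => abs_nonneg _) fun s _ => hbb s).trans ?_
        rw [Finset.prod_const]
        exact pow_le_pow_right₀ (by norm_num) hTM
      have e2 : |∏ s ∈ U \ T, a s| ≤ 1 := by
        rw [Finset.abs_prod]
        exact Finset.prod_le_one (fun _ _ => abs_nonneg _) fun s _ => haa s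
      have e3 := h T ⟨s₀, hsT⟩ hTM
      have e12 : |∏ s ∈ T, b s| * |∏ s ∈ U \ T, a s| ≤ 2 ^ M := by
        simpa using mul_le_mul e1 e2 (abs_nonneg _) (by positivity)
      exact mul_le_mul e12 e3 (abs_nonneg _) (by positivity)
    · have : ∏ s ∈ U \ T, a s = 0 :=
        Finset.prod_eq_zero (Finset.mem_sdiff.2 ⟨hs, hsT⟩) ha0
      rw [this]
      simp only [abs_zero, mul_zero, zero_mul]
      positivity
  refine (Finset.sum_le_card_nsmul _ _ _ hterm).trans ?_
  rw [nsmul_eq_mul, Finset.card_powerset, ← mul_assoc]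
  refine mul_le_mul_of_nonneg_right ?_ hκ
  push_cast
  calc (2 : ℝ) ^ U.card * 2 ^ M ≤ 2 ^ M * 2 ^ M :=
        mul_le_mul_of_nonneg_right (pow_le_pow_right₀ (by norm_num) hU) (by positivity)
    _ = 4 ^ M := by rw [← mul_pow]; norm_num

/-- The mean of `η̄_x η̄_{x'} ∏_C η̄ ∏_D η̄` is as small as the correlations as soon as some site
occurs exactly once in the product. -/
theorem CorrBound.abs_integral_quad_le {M : ℕ} {κ : ℝ} (h : CorrBound μ M κ)
    {x x' : ZMod n} {C D : Finset (ZMod n)} (hM : 2 + C.card + D.card ≤ M) {s₀ : ZMod n}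
    (hs : (if s₀ = x then 1 else 0) + (if s₀ = x' then 1 else 0) + (if s₀ ∈ C then 1 else 0) +
      (if s₀ ∈ D then 1 else 0) = 1) :
    |∫ η, cent μ η x * cent μ η x' * (∏ s ∈ C, cent μ η s) * ∏ s ∈ D, cent μ η s ∂μ|
      ≤ 4 ^ M * κ := by
  classical
  let U : Finset (ZMod n) := insert x (insert x' (C ∪ D))
  let ψ : Fin 2 → ℝ := fun v => ((v : ℕ) : ℝ) - density μ
  let φ : ZMod n → Fin 2 → ℝ := fun s v =>
    (if s = x then ψ v else 1) * (if s = x' then ψ v else 1) * (if s ∈ C then ψ v else 1) *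
      (if s ∈ D then ψ v else 1)
  have hψ : ∀ v, |ψ v| ≤ 1 := fun v => by
    have := abs_cent_le (μ := μ) (fun _ => v) 0
    exact this
  have hite : ∀ (p : Prop) [Decidable p] (v : Fin 2), |if p then ψ v else 1| ≤ 1 := by
    intro p _ v
    split_ifs
    · exact hψ v
    · simp
  have hU : U.card ≤ M := by
    have h1 := Finset.card_insert_le x (insert x' (C ∪ D))
    have h2 := Finset.card_insert_le x' (C ∪ D)
    have h3 := Finset.card_union_le C D
    simp only [U]
    omega
  have hsU : s₀ ∈ U := by
    simp only [U, Finset.mem_insert, Finset.mem_union]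
    by_contra hcon
    push Not at hcon
    simp [hcon.1, hcon.2.1, hcon.2.2.1, hcon.2.2.2] at hs
  have key := h.abs_integral_prod_le hU hsU φ (fun s v => by
    simp only [φ, abs_mul]
    exact mul_le_one₀ (mul_le_one₀ (mul_le_one₀ (hite _ _) (abs_nonneg _) (hite _ _))
      (abs_nonneg _) (hite _ _)) (abs_nonneg _) (hite _ _)) (fun v => by
    simp only [φ]
    split_ifs at hs ⊢ <;> simp_all [ψ])
  have hprod : ∀ η : Config n, ∏ s ∈ U, φ s (η s) =
      cent μ η x * cent μ η x' * (∏ s ∈ C, cent μ η s) * ∏ s ∈ D, cent μ η s := by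
    intro η
    simp only [φ, Finset.prod_mul_distrib]
    have hC : U ∩ C = C := Finset.inter_eq_right.2 fun s hs => by simp [U, hs]
    have hD : U ∩ D = D := Finset.inter_eq_right.2 fun s hs => by simp [U, hs]
    rw [Finset.prod_ite_eq', Finset.prod_ite_eq', Finset.prod_ite_mem, Finset.prod_ite_mem, hC, hD,
      if_pos (by simp [U]), if_pos (by simp [U])]
    rfl
  simpa only [hprod] using key

/-- Schur's test for a Gram matrix. -/
theorem integral_sq_sum_le (A : ZMod n → Config n → ℝ) (v : ZMod n → ℝ) {Λ : ℝ}
    (hΛ : ∀ x, ∑ x', |∫ η, A x η * A x' η ∂μ| ≤ Λ) :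
    ∫ η, (∑ x, v x * A x η) ^ 2 ∂μ ≤ Λ * ∑ x, v x ^ 2 := by
  set m : ZMod n → ZMod n → ℝ := fun x x' => |∫ η, A x η * A x' η ∂μ| with hm
  have hsymm : ∀ x x', m x x' = m x' x := fun x x' => by simp only [hm, mul_comm]
  have e : ∫ η, (∑ x, v x * A x η) ^ 2 ∂μ =
      ∑ x, ∑ x', v x * v x' * ∫ η, A x η * A x' η ∂μ := by
    simp only [sq, Finset.sum_mul_sum]
    rw [integral_finsetSum _ fun _ _ => Integrable.of_finite]
    refine Finset.sum_congr rfl fun x _ => ?_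
    rw [integral_finsetSum _ fun _ _ => Integrable.of_finite]
    refine Finset.sum_congr rfl fun x' _ => ?_
    rw [← integral_const_mul]
    refine integral_congr_ae (Eventually.of_forall fun η => ?_)
    simp only
    ring
  rw [e]
  calc ∑ x, ∑ x', v x * v x' * ∫ η, A x η * A x' η ∂μ
      ≤ ∑ x, ∑ x', (1 / 2 * (v x ^ 2 * m x x') + 1 / 2 * (v x' ^ 2 * m x x')) := by
        refine Finset.sum_le_sum fun x _ => Finset.sum_le_sum fun x' _ => ?_
        have h1 : v x * v x' * ∫ η, A x η * A x' η ∂μ ≤ |v x * v x'| * m x x' := by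
          rw [hm, ← abs_mul]
          exact le_abs_self _
        have h2 : |v x * v x'| ≤ 1 / 2 * (v x ^ 2 + v x' ^ 2) := by
          rw [abs_le]
          constructor <;> nlinarith [sq_nonneg (v x + v x'), sq_nonneg (v x - v x')]
        nlinarith [mul_le_mul_of_nonneg_right h2 (abs_nonneg (∫ η, A x η * A x' η ∂μ))]
    _ = ∑ x, v x ^ 2 * ∑ x', m x x' := by
        have e2 : ∑ x, ∑ x', 1 / 2 * (v x' ^ 2 * m x x') =
            ∑ x, ∑ x', 1 / 2 * (v x ^ 2 * m x x') := by
          rw [Finset.sum_comm]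
          refine Finset.sum_congr rfl fun x _ => Finset.sum_congr rfl fun x' _ => ?_
          rw [hsymm]
        simp only [Finset.sum_add_distrib]
        rw [e2, ← Finset.sum_add_distrib]
        refine Finset.sum_congr rfl fun x _ => ?_
        rw [← Finset.sum_add_distrib, Finset.mul_sum]
        refine Finset.sum_congr rfl fun x' _ => ?_
        ring
    _ ≤ ∑ x, v x ^ 2 * Λ :=
        Finset.sum_le_sum fun x _ => mul_le_mul_of_nonneg_left (hΛ x) (sq_nonneg _)
    _ = Λ * ∑ x, v x ^ 2 := by rw [← Finset.sum_mul, mul_comm]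

theorem CorrBound.integral_sq_linear_le {M : ℕ} {κ : ℝ} (h : CorrBound μ M κ) (hM : 2 ≤ M)
    (v : ZMod n → ℝ) :
    ∫ η, (∑ x, v x * cent μ η x) ^ 2 ∂μ ≤ (1 + n * κ) * ∑ x, v x ^ 2 := by
  have hκ := h.nonneg (by omega)
  refine integral_sq_sum_le (fun x η => cent μ η x) v fun x => ?_
  calc ∑ x', |∫ η, cent μ η x * cent μ η x' ∂μ| ≤ ∑ x', ((if x' = x then 1 else 0) + κ) := by
        refine Finset.sum_le_sum fun x' _ => ?_
        split_ifs with hx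
        · have : |∫ η, cent μ η x * cent μ η x' ∂μ| ≤ 1 :=
            abs_integral_le_of_abs_le fun η => by
              rw [abs_mul]
              exact mul_le_one₀ (abs_cent_le _ _) (abs_nonneg _) (abs_cent_le _ _)
          linarith
        · have := h {x, x'} (by simp) ((Finset.card_le_two).trans hM)
          simp only [Finset.prod_pair (Ne.symm hx)] at this
          linarith
    _ = 1 + n * κ := by
        rw [Finset.sum_add_distrib]
        simp [ZMod.card]

end BoltzmannGibbs

namespace BoltzmannGibbs

/-- For fixed `x`, the triples `(x', k, k')` such that no site occurs exactly once among `x`, `x'`,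
`x + k + Θ` and `x' + k' + Θ` are contained in a union of `5 |Θ|²` lines: both `x` and `x'` have to
be covered by another factor, which are two constraints on the triple. -/
theorem exists_covering_triples {n : ℕ} [NeZero n] {Θ : Finset (ZMod n)} (hΘ : Θ.Nonempty)
    (x : ZMod n) :
    ∃ B : Finset (ZMod n × ZMod n × ZMod n), B.card ≤ 5 * Θ.card ^ 2 * n ∧
      ∀ x' k k', (x', k, k') ∉ B → ∃ s₀,
        (if s₀ = x then 1 else 0) + (if s₀ = x' then 1 else 0) +
          (if s₀ ∈ Θ.image (fun j => x + k + j) then 1 else 0) +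
          (if s₀ ∈ Θ.image (fun j => x' + k' + j) then 1 else 0) = 1 := by
  let line : (ZMod n × ZMod n) × Fin 5 → ZMod n → ZMod n × ZMod n × ZMod n := fun p u =>
    ![(x, u + p.1.2 - p.1.1, u), (u, -p.1.1, -p.1.2), (x - p.1.1 + p.1.2, -p.1.1, u),
      (x + p.1.2 - p.1.1, u, -p.1.2), (u, u - x - p.1.2, x - u - p.1.1)] p.2
  refine ⟨((Θ ×ˢ Θ) ×ˢ (Finset.univ : Finset (Fin 5))).biUnion
    fun p => Finset.univ.image (line p), ?_, ?_⟩
  · refine (Finset.card_biUnion_le_card_mul _ _ n fun p _ => ?_).trans ?_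
    · exact Finset.card_image_le.trans (by simp [ZMod.card])
    · simp only [Finset.card_product, Finset.card_univ, Fintype.card_fin]
      exact le_of_eq (by ring)
  · intro x' k k' hB
    by_contra hcon
    push Not at hcon
    refine hB ?_
    have hmem : ∀ i ∈ Θ, ∀ j ∈ Θ, ∀ (c : Fin 5) u, line ((i, j), c) u = (x', k, k') →
        (x', k, k') ∈ ((Θ ×ˢ Θ) ×ˢ (Finset.univ : Finset (Fin 5))).biUnion
          fun p => Finset.univ.image (line p) := by
      intro i hi j hj c u hu
      simp only [Finset.mem_biUnion, Finset.mem_image, Finset.mem_product]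
      exact ⟨((i, j), c), ⟨⟨hi, hj⟩, Finset.mem_univ _⟩, u, Finset.mem_univ _, hu⟩
    obtain ⟨i, hi⟩ := hΘ
    by_cases hx : x' = x
    · subst hx
      by_cases hd : ∃ a ∈ Θ, ∃ b ∈ Θ, x' + k + a = x' + k' + b
      · obtain ⟨a, ha, b, hb, hab⟩ := hd
        refine hmem a ha b hb 0 k' ?_
        have : k = k' + b - a := by linear_combination hab
        simp [line, this]
      · push Not at hd
        -- the two translates of `Θ` are disjoint, so at most one of them can be `{x}`
        have h1 : x' + k + i = x' := by
          by_contra hne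
          refine hcon (x' + k + i) ?_
          have hC : x' + k + i ∈ Θ.image (fun j => x' + k + j) := Finset.mem_image_of_mem _ hi
          have hD : x' + k + i ∉ Θ.image (fun j => x' + k' + j) := by
            intro h
            obtain ⟨b, hb, hbe⟩ := Finset.mem_image.1 h
            exact hd i hi b hb hbe.symm
          rw [if_neg hne, if_pos hC, if_neg hD]
        have h2 : x' + k' + i = x' := by
          by_contra hne
          refine hcon (x' + k' + i) ?_
          have hD : x' + k' + i ∈ Θ.image (fun j => x' + k' + j) := Finset.mem_image_of_mem _ hi
          have hC : x' + k' + i ∉ Θ.image (fun j => x' + k + j) := by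
            intro h
            obtain ⟨b, hb, hbe⟩ := Finset.mem_image.1 h
            exact hd b hb i hi hbe
          rw [if_neg hne, if_neg hC, if_pos hD]
        exact absurd (h1.trans h2.symm) (hd i hi i hi)
    · have h1 : x ∈ Θ.image (fun j => x + k + j) ∨ x ∈ Θ.image (fun j => x' + k' + j) := by
        by_contra hn
        push Not at hn
        exact hcon x (by rw [if_pos rfl, if_neg (Ne.symm hx), if_neg hn.1, if_neg hn.2])
      have h2 : x' ∈ Θ.image (fun j => x + k + j) ∨ x' ∈ Θ.image (fun j => x' + k' + j) := by
        by_contra hn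
        push Not at hn
        exact hcon x' (by rw [if_pos rfl, if_neg hx, if_neg hn.1, if_neg hn.2])
      simp only [Finset.mem_image] at h1 h2
      rcases h1 with ⟨a, ha, hae⟩ | ⟨a, ha, hae⟩ <;> rcases h2 with ⟨b, hb, hbe⟩ | ⟨b, hb, hbe⟩
      · refine hmem a ha b hb 2 k' ?_
        have hk : k = -a := by linear_combination hae
        have hx' : x' = x - a + b := by rw [← hbe, hk]; ring
        simp [line, ← hk, ← hx']
      · refine hmem a ha b hb 1 x' ?_
        have hk : k = -a := by linear_combination hae
        have hk' : k' = -b := by linear_combination hbe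
        simp [line, hk, hk']
      · refine hmem a ha b hb 4 x' ?_
        have hk : k = x' - x - b := by linear_combination hbe
        have hk' : k' = x - x' - a := by linear_combination hae
        simp [line, hk, hk']
      · refine hmem a ha b hb 3 k ?_
        have hk' : k' = -b := by linear_combination hbe
        have hx' : x' = x + b - a := by linear_combination hae - hk'
        simp [line, ← hk', ← hx']

variable {n : ℕ} [NeZero n] {μ : Measure (Config n)} [IsProbabilityMeasure μ]

/-- The field `∑_x v_x η̄_x ∑_k W_k Q_{x+k}` with `Q_z = ∏_{j ∈ Θ} η̄_{z+j}` has a second moment of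
order `(n + n L² κ) ∑_x v_x²`, where `L` bounds the total weight of `W`. By Schur's test it suffices
to sum the Gram matrix over `x'`, `k` and `k'` for fixed `x`. -/
theorem CorrBound.integral_sq_monomial_le {M : ℕ} {κ : ℝ} (h : CorrBound μ M κ)
    {Θ : Finset (ZMod n)} (hΘ : Θ.Nonempty) (hM : 2 + 2 * Θ.card ≤ M)
    {W : ZMod n → ℝ} (hW : ∀ k, |W k| ≤ 1) {L : ℝ} (hL : ∑ k, |W k| ≤ L) (v : ZMod n → ℝ) :
    ∫ η, (∑ x, v x * (cent μ η x * ∑ k, W k * ∏ j ∈ Θ, cent μ η (x + k + j))) ^ 2 ∂μ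
      ≤ (5 * Θ.card ^ 2 * n + n * L ^ 2 * (4 ^ M * κ)) * ∑ x, v x ^ 2 := by
  have hκ := h.nonneg (by omega)
  have hL0 : 0 ≤ ∑ k, |W k| := Finset.sum_nonneg fun _ _ => abs_nonneg _
  refine integral_sq_sum_le (fun x η => cent μ η x * ∑ k, W k * ∏ j ∈ Θ, cent μ η (x + k + j)) v
    fun x => ?_
  obtain ⟨B, hBc, hB⟩ := exists_covering_triples hΘ x
  have hpt : ∀ x' k k',
      |∫ η, cent μ η x * cent μ η x' * (∏ j ∈ Θ, cent μ η (x + k + j)) *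
        ∏ j ∈ Θ, cent μ η (x' + k' + j) ∂μ| ≤ (if (x', k, k') ∈ B then 1 else 0) + 4 ^ M * κ := by
    intro x' k k'
    have hinj : ∀ y : ZMod n, Set.InjOn (fun j => y + j) (Θ : Set (ZMod n)) := fun y =>
      (add_right_injective y).injOn
    have hprod : ∀ (y : ZMod n) (η : Config n), ∏ j ∈ Θ, cent μ η (y + j) =
        ∏ s ∈ Θ.image (fun j => y + j), cent μ η s := fun y η =>
      (Finset.prod_image (hinj y)).symm
    simp only [hprod]
    split_ifs with hb
    · refine le_add_of_le_of_nonneg (abs_integral_le_of_abs_le fun η => ?_) (by positivity)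
      rw [abs_mul, abs_mul, abs_mul]
      exact mul_le_one₀ (mul_le_one₀ (mul_le_one₀ (abs_cent_le _ _) (abs_nonneg _)
        (abs_cent_le _ _)) (abs_nonneg _) (abs_prod_cent_le _ _)) (abs_nonneg _)
        (abs_prod_cent_le _ _)
    · rw [zero_add]
      obtain ⟨s₀, hs₀⟩ := hB x' k k' hb
      refine h.abs_integral_quad_le ?_ hs₀
      rw [Finset.card_image_of_injOn (hinj _), Finset.card_image_of_injOn (hinj _)]
      omega
  have hx' : ∀ x', |∫ η, (cent μ η x * ∑ k, W k * ∏ j ∈ Θ, cent μ η (x + k + j)) *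
      (cent μ η x' * ∑ k, W k * ∏ j ∈ Θ, cent μ η (x' + k + j)) ∂μ| ≤
      ∑ k, ∑ k', ((if (x', k, k') ∈ B then 1 else 0) + |W k| * |W k'| * (4 ^ M * κ)) := by
    intro x'
    have e : ∫ η, (cent μ η x * ∑ k, W k * ∏ j ∈ Θ, cent μ η (x + k + j)) *
        (cent μ η x' * ∑ k, W k * ∏ j ∈ Θ, cent μ η (x' + k + j)) ∂μ =
        ∑ k, ∑ k', W k * W k' * ∫ η, cent μ η x * cent μ η x' *
          (∏ j ∈ Θ, cent μ η (x + k + j)) * ∏ j ∈ Θ, cent μ η (x' + k' + j) ∂μ := by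
      simp only [← integral_const_mul]
      have := fun k => integral_finsetSum (μ := μ) (Finset.univ : Finset (ZMod n))
        (f := fun k' η => W k * W k' * (cent μ η x * cent μ η x' *
          (∏ j ∈ Θ, cent μ η (x + k + j)) * ∏ j ∈ Θ, cent μ η (x' + k' + j)))
        fun _ _ => Integrable.of_finite
      simp only [← this]
      rw [← integral_finsetSum _ fun _ _ => Integrable.of_finite]
      refine integral_congr_ae (Eventually.of_forall fun η => ?_)
      simp only
      rw [mul_mul_mul_comm, Finset.sum_mul_sum, Finset.mul_sum]
      refine Finset.sum_congr rfl fun k _ => ?_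
      rw [Finset.mul_sum]
      refine Finset.sum_congr rfl fun k' _ => ?_
      ring
    rw [e]
    refine (Finset.abs_sum_le_sum_abs _ _).trans (Finset.sum_le_sum fun k _ => ?_)
    refine (Finset.abs_sum_le_sum_abs _ _).trans (Finset.sum_le_sum fun k' _ => ?_)
    rw [abs_mul, abs_mul]
    have hWW : |W k| * |W k'| ≤ 1 := mul_le_one₀ (hW k) (abs_nonneg _) (hW k')
    have hWW0 : 0 ≤ |W k| * |W k'| := by positivity
    refine (mul_le_mul_of_nonneg_left (hpt x' k k') hWW0).trans ?_
    rw [mul_add]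
    gcongr
    split_ifs <;> linarith
  have hcount : ∑ x', ∑ k, ∑ k', (if (x', k, k') ∈ B then (1 : ℝ) else 0) = B.card := by
    have : ∑ p : ZMod n × ZMod n × ZMod n, (if p ∈ B then (1 : ℝ) else 0) = B.card := by simp
    rw [← this]
    simp only [Fintype.sum_prod_type]
  calc _ ≤ ∑ x', ∑ k, ∑ k', ((if (x', k, k') ∈ B then 1 else 0) +
        |W k| * |W k'| * (4 ^ M * κ)) := Finset.sum_le_sum fun x' _ => hx' x'
    _ = B.card + n * (∑ k, |W k|) ^ 2 * (4 ^ M * κ) := by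
        simp only [Finset.sum_add_distrib]
        rw [hcount]
        congr 1
        simp only [← Finset.sum_mul]
        rw [Finset.sum_const, Finset.card_univ, ZMod.card, nsmul_eq_mul, sq, Finset.sum_mul_sum]
    _ ≤ 5 * Θ.card ^ 2 * n + n * L ^ 2 * (4 ^ M * κ) := by
        gcongr
        exact_mod_cast hBc

end BoltzmannGibbs

/-! ### Integration by parts and the variational bound -/

namespace BoltzmannGibbs

theorem swapConf_swapConf {n : ℕ} (x y : ZMod n) (η : Config n) :
    swapConf x y (swapConf x y η) = η := by
  funext z
  simp [swapConf]

theorem cent_swapConf {n : ℕ} (μ : Measure (Config n)) (x y : ZMod n) (η : Config n) (z : ZMod n) :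
    cent μ (swapConf x y η) z = cent μ η (Equiv.swap x y z) := rfl

/-- The discrete gradient `η_z - η_{z+1}`. -/
noncomputable def grad {n : ℕ} (μ : Measure (Config n)) (η : Config n) (z : ZMod n) : ℝ :=
  cent μ η z - cent μ η (z + 1)

theorem abs_grad_le {n : ℕ} (μ : Measure (Config n)) (η : Config n) (z : ZMod n) :
    |grad μ η z| ≤ 1 := by
  have : grad μ η z = occ η z - occ η (z + 1) := by simp [grad, cent]
  rw [this, abs_le]
  constructor <;>
    linarith [occ_nonneg η z, occ_le_one η z, occ_nonneg η (z + 1), occ_le_one η (z + 1)]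

theorem grad_swapConf {n : ℕ} (μ : Measure (Config n)) (η : Config n) (z : ZMod n) :
    grad μ (swapConf z (z + 1) η) z = -grad μ η z := by
  simp [grad, cent_swapConf]

/-- The field `∑_x v_x η̄_x ∑_k W_k (η_{x+k} - η_{x+k+1})`. -/
noncomputable def gradField {n : ℕ} [NeZero n] (μ : Measure (Config n)) (v W : ZMod n → ℝ)
    (η : Config n) : ℝ :=
  ∑ x, v x * (cent μ η x * ∑ k, W k * grad μ η (x + k))

/-- The part of `gradField` which integration by parts cannot control by the Dirichlet form; it
comes from the lack of invariance of `μ` under nearest-neighbour swaps. -/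
noncomputable def drift {n : ℕ} [NeZero n] (μ : Measure (Config n)) (v W : ZMod n → ℝ)
    (η : Config n) : ℝ :=
  -(1 / 2) * ∑ x, v x *
    (cent μ η x * ∑ k, W k * ((swapRatio μ η (x + k) - 1) * grad μ η (x + k)))

/-- The coefficient of the gradient at `z` in `gradField`. -/
noncomputable def gradCoeff {n : ℕ} [NeZero n] (μ : Measure (Config n)) (v W : ZMod n → ℝ)
    (z : ZMod n) (η : Config n) : ℝ :=
  ∑ x, (v x * W (z - x)) * cent μ η x

section

variable {n : ℕ} [NeZero n] {μ : Measure (Config n)}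

theorem gradField_sub_drift (v W : ZMod n → ℝ) (η : Config n) :
    gradField μ v W η - drift μ v W η =
      ∑ z, gradCoeff μ v W z η * (grad μ η z + 1 / 2 * ((swapRatio μ η z - 1) * grad μ η z)) := by
  simp only [gradField, drift, gradCoeff, Finset.sum_mul]
  rw [Finset.sum_comm, Finset.mul_sum, ← Finset.sum_sub_distrib]
  refine Finset.sum_congr rfl fun x _ => ?_
  simp only [Finset.mul_sum]
  rw [← Finset.sum_sub_distrib]
  refine Fintype.sum_equiv (Equiv.addLeft x) _ _ fun k => ?_
  simp only [Equiv.coe_addLeft, add_sub_cancel_left]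
  ring

theorem gradCoeff_swapConf {v W : ZMod n → ℝ} (hW0 : W 0 = 0) (hW1 : W (-1) = 0) (z : ZMod n)
    (η : Config n) :
    gradCoeff μ v W z (swapConf z (z + 1) η) = gradCoeff μ v W z η := by
  refine Finset.sum_congr rfl fun x _ => ?_
  by_cases h1 : x = z
  · simp [h1, hW0]
  by_cases h2 : x = z + 1
  · simp [h2, hW1]
  rw [cent_swapConf, Equiv.swap_apply_of_ne_of_ne h1 h2]

/-- Integration by parts for a nearest-neighbour swap: the change of variables `η ↦ η^{z,z+1}`
changes the sign of the gradient and multiplies the weight by the swap ratio. -/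
theorem integral_mul_grad [IsFiniteMeasure μ]
    (hμ : ∀ z η, μ.real {swapConf z (z + 1) η} = μ.real {η} * swapRatio μ η z) {z : ZMod n}
    {g : Config n → ℝ} (hg : ∀ η, g (swapConf z (z + 1) η) = g η) (f : Config n → ℝ) :
    2 * ∫ η, (g η * (grad μ η z + 1 / 2 * ((swapRatio μ η z - 1) * grad μ η z))) * f η ∂μ =
      ∫ η, g η * grad μ η z * swapRatio μ η z * (f η - f (swapConf z (z + 1) η)) ∂μ := by
  rw [integral_config, integral_config]
  have hswap : ∑ η, μ.real {η} * (g η * grad μ η z * f η) =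
      -∑ η, μ.real {η} * (g η * grad μ η z * swapRatio μ η z * f (swapConf z (z + 1) η)) := by
    have hinv : Function.Involutive (swapConf (N := n) z (z + 1)) := swapConf_swapConf z (z + 1)
    rw [← Equiv.sum_comp hinv.toPerm, ← Finset.sum_neg_distrib]
    refine Finset.sum_congr rfl fun η _ => ?_
    simp only [Function.Involutive.coe_toPerm]
    rw [hμ, hg, grad_swapConf]
    ring
  have e1 : 2 * ∑ η, μ.real {η} *
      ((g η * (grad μ η z + 1 / 2 * ((swapRatio μ η z - 1) * grad μ η z))) * f η) =
      ∑ η, μ.real {η} * (g η * grad μ η z * f η) +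
        ∑ η, μ.real {η} * (g η * grad μ η z * swapRatio μ η z * f η) := by
    rw [Finset.mul_sum, ← Finset.sum_add_distrib]
    refine Finset.sum_congr rfl fun η _ => ?_
    ring
  rw [e1, hswap, ← Finset.sum_neg_distrib, ← Finset.sum_add_distrib]
  refine Finset.sum_congr rfl fun η _ => ?_
  ring

variable [IsProbabilityMeasure μ]

/-- The `H_{-1}` bound for `gradField - drift`. -/
theorem CorrBound.two_mul_integral_sub_le {M : ℕ} {κ : ℝ} (h : CorrBound μ M κ) (hM : 2 ≤ M)
    (hμ : ∀ z η, μ.real {swapConf z (z + 1) η} = μ.real {η} * swapRatio μ η z)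
    (hR : ∀ z η, μ.real {η} ≠ 0 → |swapRatio μ η z| ≤ 2)
    {W : ZMod n → ℝ} (hW : ∀ k, |W k| ≤ 1) {L : ℝ} (hL : ∑ k, |W k| ≤ L) (hW0 : W 0 = 0)
    (hW1 : W (-1) = 0) (v : ZMod n → ℝ) {δ : ℝ} (hδ : 0 < δ) (f : Config n → ℝ) :
    2 * ∫ η, (gradField μ v W η - drift μ v W η) * f η ∂μ ≤
      δ * ∑ z, ∫ η, (f (swapConf z (z + 1) η) - f η) ^ 2 ∂μ +
        δ⁻¹ * ((1 + n * κ) * (L * ∑ x, v x ^ 2)) := by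
  have hκ := h.nonneg (by omega)
  have e1 : 2 * ∫ η, (gradField μ v W η - drift μ v W η) * f η ∂μ =
      ∑ z, ∫ η, gradCoeff μ v W z η * grad μ η z * swapRatio μ η z *
        (f η - f (swapConf z (z + 1) η)) ∂μ := by
    simp only [gradField_sub_drift, Finset.sum_mul]
    rw [integral_finsetSum _ fun _ _ => Integrable.of_finite, Finset.mul_sum]
    exact Finset.sum_congr rfl fun z _ => integral_mul_grad hμ (gradCoeff_swapConf hW0 hW1 z) f
  have e2 : ∀ z, ∫ η, gradCoeff μ v W z η * grad μ η z * swapRatio μ η z *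
        (f η - f (swapConf z (z + 1) η)) ∂μ ≤
      δ * ∫ η, (f (swapConf z (z + 1) η) - f η) ^ 2 ∂μ +
        δ⁻¹ * ∫ η, gradCoeff μ v W z η ^ 2 ∂μ := by
    intro z
    simp only [integral_config]
    rw [Finset.mul_sum, Finset.mul_sum, ← Finset.sum_add_distrib]
    refine Finset.sum_le_sum fun η _ => ?_
    by_cases hη : μ.real {η} = 0
    · simp [hη]
    set G := gradCoeff μ v W z η
    set d := f η - f (swapConf z (z + 1) η)
    set b := grad μ η z * swapRatio μ η z with hb
    have hb2 : b ^ 2 ≤ 4 := by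
      have : |b| ≤ 1 * 2 := by
        rw [hb, abs_mul]
        exact mul_le_mul (abs_grad_le μ η z) (hR z η hη) (abs_nonneg _) zero_le_one
      rw [← sq_abs]
      nlinarith [abs_nonneg b]
    have hd : (f (swapConf z (z + 1) η) - f η) ^ 2 = d ^ 2 := by ring
    rw [hd]
    -- completing the square in `d`
    have key : G * grad μ η z * swapRatio μ η z * d ≤ δ * d ^ 2 + δ⁻¹ * G ^ 2 := by
      have h1 : 0 ≤ δ * (d - δ⁻¹ * G * b / 2) ^ 2 := by positivity
      have h2 : δ * (d - δ⁻¹ * G * b / 2) ^ 2 =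
          δ * d ^ 2 - G * b * d + δ⁻¹ * G ^ 2 * b ^ 2 / 4 := by
        field_simp
        ring
      have h3 : 0 ≤ δ⁻¹ * G ^ 2 := by positivity
      have h4 : G * grad μ η z * swapRatio μ η z * d = G * b * d := by rw [hb]; ring
      nlinarith
    calc _ ≤ μ.real {η} * (δ * d ^ 2 + δ⁻¹ * G ^ 2) :=
          mul_le_mul_of_nonneg_left key measureReal_nonneg
      _ = _ := by ring
  have e3 : ∑ z, ∫ η, gradCoeff μ v W z η ^ 2 ∂μ ≤ (1 + n * κ) * (L * ∑ x, v x ^ 2) := by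
    have hW2 : ∀ k, W k ^ 2 ≤ |W k| := fun k => by
      rw [← sq_abs, sq]
      exact mul_le_of_le_one_left (abs_nonneg _) (hW k)
    calc ∑ z, ∫ η, gradCoeff μ v W z η ^ 2 ∂μ
        ≤ ∑ z, (1 + n * κ) * ∑ x, (v x * W (z - x)) ^ 2 :=
          Finset.sum_le_sum fun z _ => h.integral_sq_linear_le hM _
      _ = (1 + n * κ) * ∑ x, v x ^ 2 * ∑ k, W k ^ 2 := by
          rw [← Finset.mul_sum, Finset.sum_comm]
          congr 1
          refine Finset.sum_congr rfl fun x _ => ?_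
          rw [Finset.mul_sum]
          refine (Fintype.sum_equiv (Equiv.addLeft x) _ _ fun k => ?_).symm
          simp [mul_pow]
      _ ≤ (1 + n * κ) * ∑ x, v x ^ 2 * L := by
          gcongr with x _
          exact (Finset.sum_le_sum fun k _ => hW2 k).trans hL
      _ = _ := by rw [← Finset.sum_mul]; ring
  rw [e1]
  calc _ ≤ ∑ z, (δ * ∫ η, (f (swapConf z (z + 1) η) - f η) ^ 2 ∂μ +
        δ⁻¹ * ∫ η, gradCoeff μ v W z η ^ 2 ∂μ) := Finset.sum_le_sum fun z _ => e2 z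
    _ = δ * ∑ z, ∫ η, (f (swapConf z (z + 1) η) - f η) ^ 2 ∂μ +
        δ⁻¹ * ∑ z, ∫ η, gradCoeff μ v W z η ^ 2 ∂μ := by
      rw [Finset.sum_add_distrib, ← Finset.mul_sum, ← Finset.mul_sum]
    _ ≤ _ := by gcongr

end

/-! ### The drift -/

theorem injOn_intCast_Icc {n m₁ m₂ : ℕ} (h : m₁ + m₂ < n) :
    Set.InjOn (fun j : ℤ => (j : ZMod n)) (Finset.Icc (-(m₁ : ℤ)) (m₂ : ℤ) : Set ℤ) := by
  intro i hi j hj hij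
  simp only [Finset.coe_Icc, Set.mem_Icc] at hi hj
  have hd := (ZMod.intCast_eq_intCast_iff_dvd_sub i j n).1 hij
  have := Int.eq_zero_of_abs_lt_dvd hd (by rw [abs_lt]; constructor <;> omega)
  omega

variable {n : ℕ} [NeZero n] {μ : Measure (Config n)} [IsProbabilityMeasure μ]

/-- Static second moment of the drift, if the swap correction times the gradient is `ν` times a
local polynomial, up to an error `r`. The constant term `c ∅` of the polynomial produces the worst
contribution. -/
theorem CorrBound.integral_sq_drift_le {M : ℕ} {κ : ℝ} (h : CorrBound μ M κ)
    {m₁ m₂ : ℕ} (hn : m₁ + m₂ < n) (hM : 2 + 2 * (m₁ + m₂ + 1) ≤ M)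
    {c : Finset ℤ → ℝ} {B : ℝ} (hc : ∀ Θ, |c Θ| ≤ B) {ν r : ℝ}
    (hpoly : ∀ z η, μ.real {η} ≠ 0 →
      |(swapRatio μ η z - 1) * grad μ η z - ν * localPoly μ m₁ m₂ c η z| ≤ r)
    {W : ZMod n → ℝ} (hW : ∀ k, |W k| ≤ 1) {L : ℝ} (hL : ∑ k, |W k| ≤ L) (v : ZMod n → ℝ) :
    ∫ η, drift μ v W η ^ 2 ∂μ ≤
      (ν ^ 2 * (4 ^ (m₁ + m₂ + 1) * (c ∅ ^ 2 * L ^ 2 * (1 + n * κ) +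
          B ^ 2 * (5 * (m₁ + m₂ + 1) ^ 2 * n + n * L ^ 2 * (4 ^ M * κ)))) +
        n * L ^ 2 * r ^ 2) * ∑ x, v x ^ 2 := by
  have hκ := h.nonneg (by omega)
  have hL0 : 0 ≤ L := (Finset.sum_nonneg fun _ _ => abs_nonneg _).trans hL
  have hB0 : 0 ≤ B := (abs_nonneg _).trans (hc ∅)
  set I := Finset.Icc (-(m₁ : ℤ)) (m₂ : ℤ) with hI
  have hIc : I.card = m₁ + m₂ + 1 := by simp [hI]; omega
  let Q : Finset ℤ → Config n → ℝ := fun Θ η =>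
    ∑ x, v x * (cent μ η x * ∑ k, W k * ∏ j ∈ Θ, cent μ η (x + k + (j : ZMod n)))
  set V := ∑ x, v x ^ 2 with hV
  have hV0 : 0 ≤ V := Finset.sum_nonneg fun _ _ => sq_nonneg _
  -- the contribution of a single monomial
  have hQ : ∀ Θ ∈ I.powerset, c Θ ^ 2 * ∫ η, Q Θ η ^ 2 ∂μ ≤
      (c ∅ ^ 2 * L ^ 2 * (1 + n * κ) +
        B ^ 2 * (5 * (m₁ + m₂ + 1) ^ 2 * n + n * L ^ 2 * (4 ^ M * κ))) * V := by
    intro Θ hΘ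
    rw [Finset.mem_powerset] at hΘ
    rcases Θ.eq_empty_or_nonempty with rfl | hne
    · have e : ∀ η, Q ∅ η = ∑ x, (v x * ∑ k, W k) * cent μ η x := fun η => by
        refine Finset.sum_congr rfl fun x _ => ?_
        simp only [Finset.prod_empty, mul_one]
        ring
      have hWL : (∑ k, W k) ^ 2 ≤ L ^ 2 := by
        rw [← sq_abs]
        exact pow_le_pow_left₀ (abs_nonneg _) ((Finset.abs_sum_le_sum_abs _ _).trans hL) 2
      have h1 : ∫ η, Q ∅ η ^ 2 ∂μ ≤ (1 + n * κ) * (V * L ^ 2) := by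
        simp only [e]
        refine (h.integral_sq_linear_le (by omega) _).trans ?_
        simp only [mul_pow, ← Finset.sum_mul]
        gcongr
      calc c ∅ ^ 2 * ∫ η, Q ∅ η ^ 2 ∂μ ≤ c ∅ ^ 2 * ((1 + n * κ) * (V * L ^ 2)) := by gcongr
        _ = (c ∅ ^ 2 * L ^ 2 * (1 + n * κ)) * V := by ring
        _ ≤ _ := by
          refine mul_le_mul_of_nonneg_right (le_add_of_nonneg_right ?_) hV0
          positivity
    · have hinj : Set.InjOn (fun j : ℤ => (j : ZMod n)) (Θ : Set ℤ) :=
        (injOn_intCast_Icc hn).mono (by exact_mod_cast hΘ)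
      have hcard : (Θ.image fun j : ℤ => (j : ZMod n)).card ≤ m₁ + m₂ + 1 :=
        Finset.card_image_le.trans (hIc ▸ Finset.card_le_card hΘ)
      have e : ∀ η, Q Θ η = ∑ x, v x * (cent μ η x * ∑ k, W k *
          ∏ j ∈ Θ.image fun j : ℤ => (j : ZMod n), cent μ η (x + k + j)) := fun η => by
        simp only [Finset.prod_image hinj, Q]
      have h1 : ∫ η, Q Θ η ^ 2 ∂μ ≤
          (5 * (m₁ + m₂ + 1) ^ 2 * n + n * L ^ 2 * (4 ^ M * κ)) * V := by
        simp only [e]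
        refine (h.integral_sq_monomial_le (hne.image _) (by omega) hW hL v).trans ?_
        gcongr
        exact_mod_cast hcard
      have h2 : c Θ ^ 2 ≤ B ^ 2 := by
        rw [← sq_abs]
        exact pow_le_pow_left₀ (abs_nonneg _) (hc Θ) 2
      calc c Θ ^ 2 * ∫ η, Q Θ η ^ 2 ∂μ
          ≤ B ^ 2 * ((5 * (m₁ + m₂ + 1) ^ 2 * n + n * L ^ 2 * (4 ^ M * κ)) * V) :=
            mul_le_mul h2 h1 (integral_nonneg fun _ => sq_nonneg _) (sq_nonneg _)
        _ ≤ _ := by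
          rw [← mul_assoc]
          refine mul_le_mul_of_nonneg_right (le_add_of_nonneg_left ?_) hV0
          positivity
  have hpt : ∀ η, μ.real {η} ≠ 0 → drift μ v W η ^ 2 ≤
      ν ^ 2 * (2 ^ (m₁ + m₂ + 1) * ∑ Θ ∈ I.powerset, c Θ ^ 2 * Q Θ η ^ 2) +
        n * L ^ 2 * r ^ 2 * V := by
    intro η hη
    set q : ℝ := ∑ Θ ∈ I.powerset, c Θ * Q Θ η with hq
    set e : ℝ := ∑ x, v x * (cent μ η x * ∑ k, W k * ((swapRatio μ η (x + k) - 1) *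
      grad μ η (x + k) - ν * localPoly μ m₁ m₂ c η (x + k))) with he
    have hr : 0 ≤ r := (abs_nonneg _).trans (hpoly 0 η hη)
    have hsplit : drift μ v W η = -(1 / 2) * (ν * q + e) := by
      rw [drift]
      congr 1
      have hq' : ν * q = ∑ x, v x * (cent μ η x * ∑ k, W k *
          (ν * localPoly μ m₁ m₂ c η (x + k))) := by
        simp only [hq, Q, localPoly, Finset.mul_sum, ← hI]
        rw [Finset.sum_comm]
        refine Finset.sum_congr rfl fun x _ => ?_
        rw [Finset.sum_comm]
        refine Finset.sum_congr rfl fun k _ => Finset.sum_congr rfl fun Θ _ => ?_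
        ring
      rw [hq', he, ← Finset.sum_add_distrib]
      refine Finset.sum_congr rfl fun x _ => ?_
      rw [← mul_add, ← mul_add, ← Finset.sum_add_distrib]
      congr 2
      refine Finset.sum_congr rfl fun k _ => ?_
      ring
    have hee : e ^ 2 ≤ n * L ^ 2 * r ^ 2 * V := by
      have hin : ∀ x, |cent μ η x * ∑ k, W k * ((swapRatio μ η (x + k) - 1) *
          grad μ η (x + k) - ν * localPoly μ m₁ m₂ c η (x + k))| ≤ L * r := by
        intro x
        rw [abs_mul]
        have h1 : |∑ k, W k * ((swapRatio μ η (x + k) - 1) *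
          grad μ η (x + k) - ν * localPoly μ m₁ m₂ c η (x + k))| ≤ L * r := by
          refine (Finset.abs_sum_le_sum_abs _ _).trans ?_
          calc _ ≤ ∑ k, |W k| * r := Finset.sum_le_sum fun k _ => by
                rw [abs_mul]
                exact mul_le_mul_of_nonneg_left (hpoly _ η hη) (abs_nonneg _)
            _ ≤ L * r := by
                rw [← Finset.sum_mul]
                exact mul_le_mul_of_nonneg_right hL hr
        exact (mul_le_of_le_one_left (abs_nonneg _) (abs_cent_le _ _)).trans h1
      calc e ^ 2 ≤ (Finset.univ : Finset (ZMod n)).card * ∑ x, (v x * (cent μ η x * ∑ k, W k *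
            ((swapRatio μ η (x + k) - 1) *
              grad μ η (x + k) - ν * localPoly μ m₁ m₂ c η (x + k)))) ^ 2 :=
            sq_sum_le_card_mul_sum_sq
        _ ≤ (Finset.univ : Finset (ZMod n)).card * ∑ x, v x ^ 2 * (L * r) ^ 2 := by
            gcongr with x _
            rw [mul_pow]
            refine mul_le_mul_of_nonneg_left ?_ (sq_nonneg _)
            rw [← sq_abs]
            exact pow_le_pow_left₀ (abs_nonneg _) (hin x) 2
        _ = n * L ^ 2 * r ^ 2 * V := by
            rw [← Finset.sum_mul, Finset.card_univ, ZMod.card]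
            ring
    have hqq : q ^ 2 ≤ 2 ^ (m₁ + m₂ + 1) * ∑ Θ ∈ I.powerset, c Θ ^ 2 * Q Θ η ^ 2 := by
      refine sq_sum_le_card_mul_sum_sq.trans ?_
      rw [Finset.card_powerset, hIc]
      simp [mul_pow]
    rw [hsplit]
    nlinarith [sq_nonneg (ν * q - e), mul_le_mul_of_nonneg_left hqq (sq_nonneg ν), sq_nonneg e,
      sq_nonneg (ν * q)]
  calc ∫ η, drift μ v W η ^ 2 ∂μ
      ≤ ∫ η, (ν ^ 2 * (2 ^ (m₁ + m₂ + 1) * ∑ Θ ∈ I.powerset, c Θ ^ 2 * Q Θ η ^ 2) +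
        n * L ^ 2 * r ^ 2 * V) ∂μ := by
        rw [integral_config, integral_config]
        refine Finset.sum_le_sum fun η _ => ?_
        by_cases hη : μ.real {η} = 0
        · simp [hη]
        · exact mul_le_mul_of_nonneg_left (hpt η hη) measureReal_nonneg
    _ = ν ^ 2 * (2 ^ (m₁ + m₂ + 1) * ∑ Θ ∈ I.powerset, c Θ ^ 2 * ∫ η, Q Θ η ^ 2 ∂μ) +
        n * L ^ 2 * r ^ 2 * V := by
        rw [integral_add Integrable.of_finite Integrable.of_finite, integral_const_mul,
          integral_const_mul, integral_finsetSum _ fun _ _ => Integrable.of_finite]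
        simp only [integral_const_mul]
        simp
    _ ≤ ν ^ 2 * (2 ^ (m₁ + m₂ + 1) * ∑ Θ ∈ I.powerset, (c ∅ ^ 2 * L ^ 2 * (1 + n * κ) +
        B ^ 2 * (5 * (m₁ + m₂ + 1) ^ 2 * n + n * L ^ 2 * (4 ^ M * κ))) * V) +
        n * L ^ 2 * r ^ 2 * V := by
        refine add_le_add_left (mul_le_mul_of_nonneg_left (mul_le_mul_of_nonneg_left
          (Finset.sum_le_sum hQ) (by positivity)) (sq_nonneg _)) _
    _ = _ := by
        rw [Finset.sum_const, Finset.card_powerset, hIc, nsmul_eq_mul]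
        have : (4 : ℝ) ^ (m₁ + m₂ + 1) = 2 ^ (m₁ + m₂ + 1) * 2 ^ (m₁ + m₂ + 1) := by
          rw [← mul_pow]; norm_num
        rw [this]
        push_cast
        ring

end BoltzmannGibbs

/-! ### Products of local polynomials -/

namespace BoltzmannGibbs

theorem cent_sq {n : ℕ} (μ : Measure (Config n)) (η : Config n) (x : ZMod n) :
    cent μ η x ^ 2 = (1 - 2 * density μ) * cent μ η x + density μ * (1 - density μ) := by
  have h : occ η x ^ 2 = occ η x := by
    have : η x = 0 ∨ η x = 1 := by omega
    rcases this with e | e <;> simp [occ, e]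
  unfold cent
  linear_combination h

/-- The coefficients of `η̄_{x+i}` times a local polynomial, see `cent_mul_localPoly`. -/
def mulCoeff (θ : ℝ) (i : ℤ) (c : Finset ℤ → ℝ) (Θ : Finset ℤ) : ℝ :=
  if i ∈ Θ then c (Θ.erase i) + (1 - 2 * θ) * c Θ else θ * (1 - θ) * c (insert i Θ)

theorem cent_mul_localPoly {n : ℕ} (μ : Measure (Config n)) {m₁ m₂ : ℕ} (c : Finset ℤ → ℝ)
    (η : Config n) (x : ZMod n) {i : ℤ} (hi : i ∈ Finset.Icc (-(m₁ : ℤ)) (m₂ : ℤ)) :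
    cent μ η (x + i) * localPoly μ m₁ m₂ c η x =
      localPoly μ m₁ m₂ (mulCoeff (density μ) i c) η x := by
  unfold localPoly
  rw [← Finset.insert_erase hi, Finset.sum_powerset_insert (Finset.notMem_erase _ _),
    Finset.sum_powerset_insert (Finset.notMem_erase _ _), ← Finset.sum_add_distrib,
    ← Finset.sum_add_distrib, Finset.mul_sum]
  refine Finset.sum_congr rfl fun Θ hΘ => ?_
  have hiΘ : i ∉ Θ := fun h => Finset.notMem_erase _ _ (Finset.mem_powerset.1 hΘ h)
  rw [Finset.prod_insert hiΘ, mulCoeff, mulCoeff, if_neg hiΘ, if_pos (Finset.mem_insert_self _ _),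
    Finset.erase_insert hiΘ]
  linear_combination c (insert i Θ) * (∏ j ∈ Θ, cent μ η (x + j)) * cent_sq μ η (x + i)

theorem abs_mulCoeff_le {θ : ℝ} (h0 : 0 ≤ θ) (h1 : θ ≤ 1) (i : ℤ) {c : Finset ℤ → ℝ} {B : ℝ}
    (hc : ∀ Θ, |c Θ| ≤ B) (Θ : Finset ℤ) : |mulCoeff θ i c Θ| ≤ 2 * B := by
  have hB : 0 ≤ B := (abs_nonneg _).trans (hc ∅)
  unfold mulCoeff
  split_ifs
  · refine (abs_add_le _ _).trans ?_
    have h2 : |(1 - 2 * θ) * c Θ| ≤ 1 * B := by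
      rw [abs_mul]
      exact mul_le_mul (abs_le.2 ⟨by linarith, by linarith⟩) (hc _) (abs_nonneg _) zero_le_one
    linarith [hc (Θ.erase i)]
  · have h2 : |θ * (1 - θ) * c (insert i Θ)| ≤ 1 * B := by
      rw [abs_mul]
      exact mul_le_mul (abs_le.2 ⟨by nlinarith, by nlinarith⟩) (hc _) (abs_nonneg _) zero_le_one
    linarith

theorem abs_localPoly_le {n : ℕ} [NeZero n] (μ : Measure (Config n)) [IsProbabilityMeasure μ]
    (m₁ m₂ : ℕ) (c : Finset ℤ → ℝ) (η : Config n) (x : ZMod n) :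
    |localPoly μ m₁ m₂ c η x| ≤ ∑ Θ ∈ (Finset.Icc (-(m₁ : ℤ)) (m₂ : ℤ)).powerset, |c Θ| := by
  refine (Finset.abs_sum_le_sum_abs _ _).trans (Finset.sum_le_sum fun Θ _ => ?_)
  rw [abs_mul, Finset.abs_prod]
  exact mul_le_of_le_one_right (abs_nonneg _)
    (Finset.prod_le_one (fun _ _ => abs_nonneg _) fun _ _ => abs_cent_le _ _)

/-- The product of a local polynomial with the gradient `η_x - η_{x+1}` is again a local polynomial,
with coefficients bounded uniformly in the density. -/
theorem exists_localPoly_mul_grad {n : ℕ} [NeZero n] (μ : Measure (Config n))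
    [IsProbabilityMeasure μ] (m₁ : ℕ) {m₂ : ℕ} (hm : 1 ≤ m₂) (c : Finset ℤ → ℝ) :
    ∃ d : Finset ℤ → ℝ,
      (∀ Θ, |d Θ| ≤ 4 * ∑ Θ ∈ (Finset.Icc (-(m₁ : ℤ)) (m₂ : ℤ)).powerset, |c Θ|) ∧
      ∀ η x, localPoly μ m₁ m₂ c η x * grad μ η x = localPoly μ m₁ m₂ d η x := by
  set I := Finset.Icc (-(m₁ : ℤ)) (m₂ : ℤ) with hI
  -- the coefficients outside the window are set to zero to have a uniform bound
  let c' : Finset ℤ → ℝ := fun Θ => if Θ ∈ I.powerset then c Θ else 0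
  have hc' : ∀ Θ, |c' Θ| ≤ ∑ Θ ∈ I.powerset, |c Θ| := by
    intro Θ
    by_cases h : Θ ∈ I.powerset
    · simp only [c', if_pos h]
      exact Finset.single_le_sum (f := fun Θ => |c Θ|) (fun _ _ => abs_nonneg _) h
    · simp only [c', if_neg h, abs_zero]
      exact Finset.sum_nonneg fun _ _ => abs_nonneg _
  have hcc : ∀ η x, localPoly μ m₁ m₂ c η x = localPoly μ m₁ m₂ c' η x := fun η x =>
    Finset.sum_congr rfl fun Θ hΘ => by simp only [c', if_pos hΘ, hI]
  refine ⟨fun Θ => mulCoeff (density μ) 0 c' Θ - mulCoeff (density μ) 1 c' Θ, fun Θ => ?_,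
    fun η x => ?_⟩
  · have h0 := abs_mulCoeff_le (density_nonneg μ) (density_le_one μ) 0 hc' Θ
    have h1 := abs_mulCoeff_le (density_nonneg μ) (density_le_one μ) 1 hc' Θ
    exact (abs_sub _ _).trans (by linarith)
  · have h0 := cent_mul_localPoly μ c' η x (i := 0) (m₁ := m₁) (m₂ := m₂) (by simp)
    have h1 := cent_mul_localPoly μ c' η x (i := 1) (m₁ := m₁) (m₂ := m₂)
      (by simp only [Finset.mem_Icc]; omega)
    simp only [Int.cast_zero, add_zero, Int.cast_one] at h0 h1
    have hsub : localPoly μ m₁ m₂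
        (fun Θ => mulCoeff (density μ) 0 c' Θ - mulCoeff (density μ) 1 c' Θ) η x =
        localPoly μ m₁ m₂ (mulCoeff (density μ) 0 c') η x -
          localPoly μ m₁ m₂ (mulCoeff (density μ) 1 c') η x := by
      simp only [localPoly, sub_mul, Finset.sum_sub_distrib]
    rw [hsub, ← h0, ← h1, hcc, grad]
    ring

/-! ### Consequences of the assumptions on the stationary measures -/

theorem integral_cent_eq_zero {n : ℕ} [NeZero n] {μ : Measure (Config n)} [IsProbabilityMeasure μ]
    (h : IsTranslationInvariant μ) (x : ZMod n) : ∫ η, cent μ η x ∂μ = 0 := by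
  have hx : ∫ η, occ η x ∂μ = density μ := by
    unfold density
    conv_rhs => rw [← h x]
    rw [integral_map (measurable_of_finite _).aemeasurable
      (measurable_of_finite _).aestronglyMeasurable]
    simp [occ, shift]
  unfold cent
  rw [integral_sub Integrable.of_finite Integrable.of_finite, hx]
  simp

theorem exists_corrBound {S : ParticleSystem} {α β : ℝ} (h₁ : NearlySwapInvariant S α)
    (h₂ : CorrelationDecay S β) {ρ : ℝ} (hρ : ρ ∈ S.I) (M : ℕ) :
    ∃ C : ℝ, 0 ≤ C ∧ ∀ N : ℕ+, CorrBound (S.ν ρ N) M (C * (N : ℝ) ^ (-β)) := by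
  have h2 : ∀ m : ℕ, ∃ C : ℝ, 2 ≤ m → ∀ (N : ℕ+) (x : Fin m → ZMod N), Function.Injective x →
      |∫ η, ∏ j, cent (S.ν ρ N) η (x j) ∂(S.ν ρ N)| ≤ C * (N : ℝ) ^ (-β) := by
    intro m
    by_cases hm : 2 ≤ m
    · obtain ⟨C, hC⟩ := h₂ ρ hρ m hm
      exact ⟨C, fun _ => hC⟩
    · exact ⟨0, fun h => absurd h hm⟩
  choose C hC using h2
  refine ⟨∑ m ∈ Finset.range (M + 1), |C m|, Finset.sum_nonneg fun _ _ => abs_nonneg _, ?_⟩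
  intro N A hA hAM
  obtain ⟨hprob, -, htr⟩ := (h₁ ρ hρ).1 N
  have hN : (0 : ℝ) ≤ (N : ℝ) ^ (-β) := Real.rpow_nonneg (Nat.cast_nonneg _) _
  by_cases hcard : 2 ≤ A.card
  · have h := hC A.card hcard N (fun j => (A.equivFin.symm j : ZMod N))
      (Subtype.val_injective.comp A.equivFin.symm.injective)
    have e : ∀ η : Config N, ∏ j, cent (S.ν ρ N) η (A.equivFin.symm j : ZMod N) =
        ∏ x ∈ A, cent (S.ν ρ N) η x := fun η => by
      rw [Equiv.prod_comp A.equivFin.symm fun x : A => cent (S.ν ρ N) η (x : ZMod N),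
        Finset.prod_coe_sort]
    simp only [e] at h
    refine h.trans (mul_le_mul_of_nonneg_right ?_ hN)
    exact (le_abs_self _).trans (Finset.single_le_sum (f := fun m => |C m|)
      (fun _ _ => abs_nonneg _) (Finset.mem_range.2 (Nat.lt_succ_of_le hAM)))
  · have h1 : A.card = 1 := by
      have := hA.card_pos
      omega
    obtain ⟨x, rfl⟩ := Finset.card_eq_one.1 h1
    simp only [Finset.prod_singleton, integral_cent_eq_zero htr x, abs_zero]
    exact mul_nonneg (Finset.sum_nonneg fun _ _ => abs_nonneg _) hN

theorem tendsto_pnat_rpow_neg {a : ℝ} (ha : 0 < a) :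
    Tendsto (fun N : ℕ+ => (N : ℝ) ^ (-a)) atTop (𝓝 0) :=
  (tendsto_rpow_neg_atTop ha).comp
    (tendsto_natCast_atTop_atTop.comp tendsto_PNat_val_atTop_atTop)

/-- For large `N` the measures `ν` are quasi-invariant under nearest-neighbour swaps. In particular
their supports are invariant under swaps. -/
theorem eventually_swapRatio {S : ParticleSystem} {α : ℝ} (h₁ : NearlySwapInvariant S α)
    (hα : 0 < α) {ρ : ℝ} (hρ : ρ ∈ S.I) :
    ∀ᶠ N : ℕ+ in atTop,
      (∀ z η, (S.ν ρ N).real {swapConf z (z + 1) η} =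
        (S.ν ρ N).real {η} * swapRatio (S.ν ρ N) η z) ∧
      ∀ z η, (S.ν ρ N).real {η} ≠ 0 → |swapRatio (S.ν ρ N) η z| ≤ 2 := by
  obtain ⟨hbasic, m₁, m₂, c, K, -, hK⟩ := h₁ ρ hρ
  set B := ∑ Θ ∈ (Finset.Icc (-(m₁ : ℤ)) (m₂ : ℤ)).powerset, |c Θ| with hB
  have hlim : Tendsto (fun N : ℕ+ => (N : ℝ) ^ (-α) * B + K * (N : ℝ) ^ (-(2 * α))) atTop
      (𝓝 (0 * B + K * 0)) :=
    ((tendsto_pnat_rpow_neg hα).mul_const B).add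
      ((tendsto_pnat_rpow_neg (by positivity)).const_mul K)
  have hev := hlim.eventually (gt_mem_nhds (show 0 * B + K * 0 < (1 : ℝ) by norm_num))
  filter_upwards [hev] with N hN
  obtain ⟨hprob, -, -⟩ := hbasic N
  set μ := S.ν ρ N with hμ
  have hR : ∀ z η, μ.real {η} ≠ 0 → |swapRatio μ η z - 1| < 1 := by
    intro z η hη
    have h1 := hK N z η hη
    have h2 := abs_localPoly_le μ m₁ m₂ c η z
    have hN0 : (0 : ℝ) ≤ (N : ℝ) ^ (-α) := Real.rpow_nonneg (Nat.cast_nonneg _) _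
    calc |swapRatio μ η z - 1| = |(swapRatio μ η z - (1 + (N : ℝ) ^ (-α) *
          localPoly μ m₁ m₂ c η z)) + (N : ℝ) ^ (-α) * localPoly μ m₁ m₂ c η z| := by ring_nf
      _ ≤ K * (N : ℝ) ^ (-(2 * α)) + (N : ℝ) ^ (-α) * B := by
        refine (abs_add_le _ _).trans (add_le_add h1 ?_)
        rw [abs_mul, abs_of_nonneg hN0]
        exact mul_le_mul_of_nonneg_left h2 hN0
      _ < 1 := by linarith
  have hsupp : ∀ z η, μ.real {η} ≠ 0 → μ.real {swapConf z (z + 1) η} ≠ 0 := by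
    intro z η hη h0
    have := hR z η hη
    rw [swapRatio, h0] at this
    simp at this
  refine ⟨fun z η => ?_, fun z η hη => ?_⟩
  · by_cases hη : μ.real {η} = 0
    · rw [hη, zero_mul]
      by_contra h0
      have := hsupp z _ h0
      rw [swapConf_swapConf] at this
      exact this hη
    · rw [swapRatio, mul_div_cancel₀ _ hη]
  · have := abs_lt.1 (hR z η hη)
    rw [abs_le]
    constructor <;> linarith [this.1, this.2]

/-- The swap correction times the gradient is `N^{-α}` times a local polynomial with bounded
coefficients, up to an error of order `N^{-2α}`. -/
def GradExpansion (S : ParticleSystem) (α ρ : ℝ) (m₁ m₂ : ℕ) (c : ℕ+ → Finset ℤ → ℝ) (K : ℝ) :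
    Prop :=
  (∀ N Θ, |c N Θ| ≤ K) ∧ ∀ (N : ℕ+) (z : ZMod N) (η : Config N), (S.ν ρ N).real {η} ≠ 0 →
    |(swapRatio (S.ν ρ N) η z - 1) * grad (S.ν ρ N) η z
        - (N : ℝ) ^ (-α) * localPoly (S.ν ρ N) m₁ m₂ (c N) η z| ≤ K * (N : ℝ) ^ (-(2 * α))

theorem NoConstantTerm.exists_gradExpansion {S : ParticleSystem} {α : ℝ} (h : NoConstantTerm S α)
    {ρ : ℝ} (hρ : ρ ∈ S.I) :
    ∃ m₁ m₂ c K, GradExpansion S α ρ m₁ m₂ c K ∧ ∀ N, c N ∅ = 0 := by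
  obtain ⟨m₁, m₂, c, K, -, h0, hc, hK⟩ := h ρ hρ
  exact ⟨m₁, m₂, c, K, ⟨hc, hK⟩, h0⟩

theorem NearlySwapInvariant.exists_gradExpansion {S : ParticleSystem} {α : ℝ}
    (h : NearlySwapInvariant S α) {ρ : ℝ} (hρ : ρ ∈ S.I) :
    ∃ m₁ m₂ c K, GradExpansion S α ρ m₁ m₂ c K := by
  obtain ⟨hbasic, m₁, m₂, c, K, hm, hK⟩ := h ρ hρ
  have hex : ∀ N : ℕ+, ∃ d : Finset ℤ → ℝ,
      (∀ Θ, |d Θ| ≤ 4 * ∑ Θ ∈ (Finset.Icc (-(m₁ : ℤ)) (m₂ : ℤ)).powerset, |c Θ|) ∧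
      ∀ η x, localPoly (S.ν ρ N) m₁ m₂ c η x * grad (S.ν ρ N) η x =
        localPoly (S.ν ρ N) m₁ m₂ d η x := fun N => by
    obtain ⟨hprob, -, -⟩ := hbasic N
    exact exists_localPoly_mul_grad _ m₁ hm c
  choose d hd hdm using hex
  refine ⟨m₁, m₂, d, max (4 * ∑ Θ ∈ (Finset.Icc (-(m₁ : ℤ)) (m₂ : ℤ)).powerset, |c Θ|) K,
    fun N Θ => (hd N Θ).trans (le_max_left _ _), fun N z η hη => ?_⟩
  have h1 := hK N z η hη
  have hN0 : (0 : ℝ) ≤ (N : ℝ) ^ (-(2 * α)) := Real.rpow_nonneg (Nat.cast_nonneg _) _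
  rw [← hdm]
  calc _ = |(swapRatio (S.ν ρ N) η z - (1 + (N : ℝ) ^ (-α) * localPoly (S.ν ρ N) m₁ m₂ c η z)) *
        grad (S.ν ρ N) η z| := by
        congr 1
        ring
    _ ≤ |swapRatio (S.ν ρ N) η z - (1 + (N : ℝ) ^ (-α) * localPoly (S.ν ρ N) m₁ m₂ c η z)| := by
        rw [abs_mul]
        exact mul_le_of_le_one_right (abs_nonneg _) (abs_grad_le _ _ _)
    _ ≤ _ := h1.trans (mul_le_mul_of_nonneg_right (le_max_right _ _) hN0)

end BoltzmannGibbs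

/-! ### Additive functionals in the diffusive time scale -/

namespace BoltzmannGibbs

/-- The second moment of `∫_0^T f(X_s) ds`. -/
noncomputable def timeMoment {N : ℕ} {Ω : Type*} [MeasurableSpace Ω] (P : Measure Ω)
    (X : ℝ → Ω → Config N) (T : ℝ) (f : Config N → ℝ) : ℝ :=
  ∫ ω, (∫ s in (0 : ℝ)..T, f (X s ω)) ^ 2 ∂P

namespace IsMarkovProcess

variable {S : ParticleSystem} {N : ℕ+} {μ : Measure (Config N)} {Ω : Type*} [MeasurableSpace Ω]
  {P : Measure Ω} {X : ℝ → Ω → Config N}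

theorem intervalIntegrable (h : IsMarkovProcess S N μ P X) (f : Config N → ℝ) {T : ℝ}
    (hT : 0 ≤ T) (ω : Ω) : IntervalIntegrable (fun s => f (X s ω)) volume 0 T := by
  obtain ⟨C, hC⟩ := exists_norm_le f
  rw [intervalIntegrable_iff_integrableOn_Ioc_of_le hT]
  have hY : Measurable fun s : ℝ => f (X (max s 0) ω) :=
    (h.measurable_uncurry f).comp (measurable_id.prodMk measurable_const)
  have hi : IntegrableOn (fun s : ℝ => f (X (max s 0) ω)) (Ioc 0 T) volume :=
    Integrable.of_bound hY.aestronglyMeasurable C (Eventually.of_forall fun s => hC _)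
  refine hi.congr_fun (fun s hs => ?_) measurableSet_Ioc
  simp only [max_eq_left hs.1.le]

theorem integrable_sq (h : IsMarkovProcess S N μ P X) (f : Config N → ℝ) {T : ℝ} (hT : 0 ≤ T) :
    Integrable (fun ω => (∫ s in (0 : ℝ)..T, f (X s ω)) ^ 2) P := by
  have := h.isProbabilityMeasure
  obtain ⟨C, hC⟩ := exists_norm_le f
  have hm : StronglyMeasurable fun ω => ∫ s in (0 : ℝ)..T, f (X s ω) := by
    have hY := ((h.measurable_uncurry f).comp measurable_swap).stronglyMeasurable
    have := hY.integral_prod_right' (ν := volume.restrict (Ioc 0 T))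
    convert this using 2 with ω
    rw [intervalIntegral.integral_of_le hT]
    refine setIntegral_congr_fun measurableSet_Ioc fun s hs => ?_
    simp [max_eq_left hs.1.le]
  refine Integrable.of_bound (hm.pow 2).aestronglyMeasurable ((C * |T - 0|) ^ 2)
    (Eventually.of_forall fun ω => ?_)
  rw [norm_pow]
  exact pow_le_pow_left₀ (norm_nonneg _)
    (intervalIntegral.norm_integral_le_of_norm_le_const fun s _ => hC _) 2

theorem timeMoment_add_le (h : IsMarkovProcess S N μ P X) (f g : Config N → ℝ) {T : ℝ}
    (hT : 0 ≤ T) :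
    timeMoment P X T (fun η => f η + g η) ≤ 2 * timeMoment P X T f + 2 * timeMoment P X T g := by
  have hf := (h.integrable_sq f hT).const_mul 2
  have hg := (h.integrable_sq g hT).const_mul 2
  have hfg := h.integrable_sq (fun η => f η + g η) hT
  unfold timeMoment
  rw [← integral_const_mul, ← integral_const_mul, ← integral_add hf hg]
  refine integral_mono hfg (hf.add hg) fun ω => ?_
  simp only
  rw [intervalIntegral.integral_add (h.intervalIntegrable f hT ω) (h.intervalIntegrable g hT ω)]
  nlinarith [sq_nonneg ((∫ s in (0 : ℝ)..T, f (X s ω)) - ∫ s in (0 : ℝ)..T, g (X s ω))]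

/-- The second moment of an average is at most the largest of the second moments. -/
theorem timeMoment_average_le (h : IsMarkovProcess S N μ P X) {L : ℕ} (hL : 0 < L)
    (f : ℕ → Config N → ℝ) {T : ℝ} (hT : 0 ≤ T) {B : ℝ}
    (hB : ∀ a ∈ Finset.Icc 1 L, timeMoment P X T (f a) ≤ B) :
    timeMoment P X T (fun η => (1 / (L : ℝ)) * ∑ a ∈ Finset.Icc 1 L, f a η) ≤ B := by
  have hL' : (0 : ℝ) < L := Nat.cast_pos.2 hL
  have hf := h.integrable_sq (fun η => (1 / (L : ℝ)) * ∑ a ∈ Finset.Icc 1 L, f a η) hT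
  have hs := (integrable_finsetSum (Finset.Icc 1 L)
    fun a _ => h.integrable_sq (f a) hT).const_mul (1 / (L : ℝ))
  calc timeMoment P X T (fun η => (1 / (L : ℝ)) * ∑ a ∈ Finset.Icc 1 L, f a η)
      ≤ ∫ ω, (1 / (L : ℝ)) * ∑ a ∈ Finset.Icc 1 L, (∫ s in (0 : ℝ)..T, f a (X s ω)) ^ 2 ∂P := by
        refine integral_mono hf hs fun ω => ?_
        simp only
        rw [intervalIntegral.integral_const_mul, intervalIntegral.integral_finsetSum
          fun a _ => h.intervalIntegrable (f a) hT ω, mul_pow]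
        have := sq_sum_le_card_mul_sum_sq (s := Finset.Icc 1 L)
          (f := fun a => ∫ s in (0 : ℝ)..T, f a (X s ω))
        rw [Nat.card_Icc, Nat.add_sub_cancel] at this
        calc _ ≤ (1 / (L : ℝ)) ^ 2 * (L * ∑ a ∈ Finset.Icc 1 L,
              (∫ s in (0 : ℝ)..T, f a (X s ω)) ^ 2) :=
              mul_le_mul_of_nonneg_left this (sq_nonneg _)
          _ = _ := by field_simp
    _ = (1 / (L : ℝ)) * ∑ a ∈ Finset.Icc 1 L, timeMoment P X T (f a) := by
        rw [integral_const_mul, integral_finsetSum _ fun a _ => h.integrable_sq (f a) hT]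
        rfl
    _ ≤ (1 / (L : ℝ)) * ∑ _a ∈ Finset.Icc 1 L, B := by
        gcongr with a ha
        exact hB a ha
    _ = B := by
        rw [Finset.sum_const, Nat.card_Icc, Nat.add_sub_cancel, nsmul_eq_mul]
        field_simp

theorem lintegral_sq_timeScale (h : IsMarkovProcess S N μ P X) (f : Config N → ℝ) {t : ℝ}
    (ht : 0 ≤ t) :
    ∫⁻ ω, ENNReal.ofReal ((∫ s in (0 : ℝ)..t, f (X (s * (N : ℝ) ^ 2) ω)) ^ 2) ∂P =
      ENNReal.ofReal (((N : ℝ) ^ 4)⁻¹ * timeMoment P X (t * (N : ℝ) ^ 2) f) := by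
  have hN : (N : ℝ) ^ 2 ≠ 0 := pow_ne_zero _ (Nat.cast_ne_zero.2 N.ne_zero)
  have e : ∀ ω, (∫ s in (0 : ℝ)..t, f (X (s * (N : ℝ) ^ 2) ω)) ^ 2 =
      ((N : ℝ) ^ 4)⁻¹ * (∫ s in (0 : ℝ)..t * (N : ℝ) ^ 2, f (X s ω)) ^ 2 := by
    intro ω
    rw [intervalIntegral.integral_comp_mul_right (fun s => f (X s ω)) hN, smul_eq_mul, mul_pow,
      zero_mul]
    congr 1
    rw [← inv_pow, ← inv_pow, ← pow_mul]
  simp only [e]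
  rw [timeMoment, ← integral_const_mul, ofReal_integral_eq_lintegral_ofReal]
  · exact (h.integrable_sq f (by positivity)).const_mul _
  · exact Eventually.of_forall fun ω => by positivity

/-- The two parts of `gradField` in the diffusive time scale: what is left after subtraction of the
drift is bounded by the Kipnis–Varadhan inequality, the drift by its static second moment. -/
theorem timeMoment_gradField_le (h : IsMarkovProcess S N μ P X) [IsProbabilityMeasure μ]
    (hst : S.IsStationary N μ) {M : ℕ} {κ : ℝ} (hcorr : CorrBound μ M κ) (hM : 2 ≤ M)
    (hμ : ∀ z η, μ.real {swapConf z (z + 1) η} = μ.real {η} * swapRatio μ η z)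
    (hR : ∀ z η, μ.real {η} ≠ 0 → |swapRatio μ η z| ≤ 2)
    {δ : ℝ} (hδ : 0 < δ)
    (hD : ∀ f : Config N → ℝ,
      δ * ∑ z, ∫ η, (f (swapConf z (z + 1) η) - f η) ^ 2 ∂μ ≤ S.dirichlet N f μ)
    {W : ZMod N → ℝ} (hW : ∀ k, |W k| ≤ 1) {L : ℝ} (hL : ∑ k, |W k| ≤ L) (hW0 : W 0 = 0)
    (hW1 : W (-1) = 0) (v : ZMod N → ℝ) {t : ℝ} (ht : 0 ≤ t) :
    ((N : ℝ) ^ 4)⁻¹ * timeMoment P X (t * (N : ℝ) ^ 2) (gradField μ v W) ≤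
      4 * t * (δ⁻¹ * ((1 + N * κ) * (L * ∑ x, v x ^ 2))) / (N : ℝ) ^ 2 +
        2 * t ^ 2 * ∫ η, drift μ v W η ^ 2 ∂μ := by
  have hN : (0 : ℝ) < N := Nat.cast_pos.2 N.pos
  have hT : 0 ≤ t * (N : ℝ) ^ 2 := by positivity
  have h1 : timeMoment P X (t * (N : ℝ) ^ 2) (fun η => gradField μ v W η - drift μ v W η) ≤
      2 * (t * (N : ℝ) ^ 2) * (δ⁻¹ * ((1 + N * κ) * (L * ∑ x, v x ^ 2))) := by
    refine h.integral_sq_integral_le hst (f := fun η => gradField μ v W η - drift μ v W η)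
      (A := δ⁻¹ * ((1 + N * κ) * (L * ∑ x, v x ^ 2))) (fun g => ?_) hT
    have := hcorr.two_mul_integral_sub_le hM hμ hR hW hL hW0 hW1 v hδ g
    linarith [hD g]
  have h2 : timeMoment P X (t * (N : ℝ) ^ 2) (drift μ v W) ≤
      (t * (N : ℝ) ^ 2) ^ 2 * ∫ η, drift μ v W η ^ 2 ∂μ :=
    h.integral_sq_integral_le_sq hst _ hT
  have h3 := h.timeMoment_add_le (fun η => gradField μ v W η - drift μ v W η) (drift μ v W) hT
  simp only [sub_add_cancel] at h3
  calc _ ≤ ((N : ℝ) ^ 4)⁻¹ *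
        (2 * (2 * (t * (N : ℝ) ^ 2) * (δ⁻¹ * ((1 + N * κ) * (L * ∑ x, v x ^ 2)))) +
        2 * ((t * (N : ℝ) ^ 2) ^ 2 * ∫ η, drift μ v W η ^ 2 ∂μ)) := by
        refine mul_le_mul_of_nonneg_left ?_ (by positivity)
        have : timeMoment P X (t * (N : ℝ) ^ 2) (gradField μ v W) =
          timeMoment P X (t * (N : ℝ) ^ 2) (fun η => gradField μ v W η) := rfl
        linarith
    _ = _ := by
        field_simp
        ring

end IsMarkovProcess

theorem SwapDirichletForm.exists_le_dirichlet {S : ParticleSystem} {α : ℝ}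
    (h : SwapDirichletForm S) (h₁ : NearlySwapInvariant S α) {ρ : ℝ} (hρ : ρ ∈ S.I) :
    ∃ δ : ℝ, 0 < δ ∧ ∀ (N : ℕ+) (f : Config N → ℝ),
      δ * ∑ z, ∫ η, (f (swapConf z (z + 1) η) - f η) ^ 2 ∂(S.ν ρ N) ≤
        S.dirichlet N f (S.ν ρ N) := by
  obtain ⟨δ, q, hδ, hq, hD⟩ := h
  refine ⟨δ, hδ, fun N f => ?_⟩
  obtain ⟨hprob, -, -⟩ := (h₁ ρ hρ).1 N
  rw [hD ρ hρ N f, Finset.mul_sum]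
  refine Finset.sum_le_sum fun z _ => ?_
  rw [← integral_const_mul]
  exact integral_mono Integrable.of_finite Integrable.of_finite fun η =>
    mul_le_mul_of_nonneg_right (hq N _).1 (sq_nonneg _)

/-- The orders of magnitude: with `y = N`, `V = N⁻¹ ∑_x v_x²` and `ℓ = L / N`, all terms of the
bound for the drift are of order `ℓ + N^{-2/3}`. -/
theorem drift_order_le {y ν κ r c B A D ℓ V e : ℝ} (hy : 0 ≤ y) (hV : 0 ≤ V) (hℓ : 0 ≤ ℓ)
    (hℓ1 : ℓ ≤ 1) (hA : 0 ≤ A) (hκ : 0 ≤ κ) (hD : 0 ≤ D) (he : 0 ≤ e)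
    (h1 : ν ^ 2 * y ^ 2 ≤ e) (h2 : ν ^ 2 * κ * y ^ 4 ≤ A) (h3 : r ^ 2 * y ^ 4 ≤ B ^ 2 * e)
    (h4 : c ^ 2 * ν ^ 2 * y ^ 3 ≤ B ^ 2) (h5 : y * κ ≤ A) {a b : ℝ} (ha : 0 ≤ a) (hb : 0 ≤ b) :
    (ν ^ 2 * (D * (c ^ 2 * (ℓ * y) ^ 2 * (1 + y * κ) +
          B ^ 2 * (a * y + y * (ℓ * y) ^ 2 * (b * κ)))) + y * (ℓ * y) ^ 2 * r ^ 2) * (y * V) ≤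
      (D * B ^ 2 * (1 + A + a + b * A) + B ^ 2) * V * (ℓ + e) := by
  have hℓ2 : ℓ ^ 2 ≤ ℓ := by nlinarith
  have hℓ21 : ℓ ^ 2 ≤ 1 := hℓ2.trans hℓ1
  have t1 : (c ^ 2 * ν ^ 2 * y ^ 3) * ℓ ^ 2 * (1 + y * κ) ≤ B ^ 2 * ℓ * (1 + A) := by
    gcongr
  have t2 : (ν ^ 2 * y ^ 2) * a ≤ e * a := by gcongr
  have t3 : (ν ^ 2 * κ * y ^ 4) * ℓ ^ 2 * b ≤ A * ℓ * b := by gcongr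
  have t4 : (r ^ 2 * y ^ 4) * ℓ ^ 2 ≤ B ^ 2 * e * 1 := by gcongr
  calc _ = (D * ((c ^ 2 * ν ^ 2 * y ^ 3) * ℓ ^ 2 * (1 + y * κ) +
          B ^ 2 * ((ν ^ 2 * y ^ 2) * a + (ν ^ 2 * κ * y ^ 4) * ℓ ^ 2 * b)) +
          (r ^ 2 * y ^ 4) * ℓ ^ 2) * V := by ring
    _ ≤ (D * (B ^ 2 * ℓ * (1 + A) + B ^ 2 * (e * a + A * ℓ * b)) + B ^ 2 * e * 1) * V := by
        gcongr
    _ ≤ (D * (B ^ 2 * (ℓ + e) * (1 + A) + B ^ 2 * ((ℓ + e) * a + A * (ℓ + e) * b)) +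
          B ^ 2 * (ℓ + e) * 1) * V := by
        gcongr <;> linarith
    _ = _ := by ring

/-- The bound which the theorem rests on: uniformly in the weights `v` and `W`, the second moment of
the time integral of `gradField` is of order `(N⁻¹ ∑_x v_x²) (L / N + N^{-2/3})`. -/
theorem exists_timeMoment_gradField_le {S : ParticleSystem} {α β : ℝ}
    (h₁ : NearlySwapInvariant S α) (h₂ : CorrelationDecay S β) (h₃ : SwapDirichletForm S)
    {ρ : ℝ} (hρ : ρ ∈ S.I) {Ω : ℕ+ → Type*} [∀ N, MeasurableSpace (Ω N)]
    {P : ∀ N : ℕ+, Measure (Ω N)} {X : ∀ N : ℕ+, ℝ → Ω N → Config N}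
    (hX : ∀ N : ℕ+, IsMarkovProcess S N (S.ν ρ N) (P N) (X N)) {t : ℝ} (ht : 0 ≤ t)
    {m₁ m₂ : ℕ} {c : ℕ+ → Finset ℤ → ℝ} {K : ℝ} (hc : GradExpansion S α ρ m₁ m₂ c K)
    (hα : 4 / 3 ≤ α) (hβ : 1 ≤ β) (hαβ : 4 ≤ 2 * α + β)
    (hconst : (∀ N, c N ∅ = 0) ∨ 3 / 2 ≤ α) :
    ∃ C : ℝ, 0 ≤ C ∧ ∀ᶠ N : ℕ+ in atTop, ∀ (W v : ZMod N → ℝ) (ℓ : ℝ), (∀ k, |W k| ≤ 1) →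
      ∑ k, |W k| ≤ ℓ * N → ℓ ≤ 1 → W 0 = 0 → W (-1) = 0 →
      ((N : ℝ) ^ 4)⁻¹ * timeMoment (P N) (X N) (t * (N : ℝ) ^ 2) (gradField (S.ν ρ N) v W) ≤
        C * ((1 / (N : ℝ)) * ∑ x, v x ^ 2) * (ℓ + (N : ℝ) ^ (-(2 / 3) : ℝ)) := by
  set M := 2 + 2 * (m₁ + m₂ + 1) with hM
  obtain ⟨A, hA, hcorr⟩ := exists_corrBound h₁ h₂ hρ M
  obtain ⟨δ, hδ, hD⟩ := h₃.exists_le_dirichlet h₁ hρ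
  obtain ⟨hcK, hpoly⟩ := hc
  have hK : 0 ≤ K := (abs_nonneg _).trans (hcK 1 ∅)
  set C₁ : ℝ := (4 : ℝ) ^ (m₁ + m₂ + 1) * K ^ 2 * (1 + A + 5 * (m₁ + m₂ + 1) ^ 2 + 4 ^ M * A) +
    K ^ 2 with hC₁
  refine ⟨4 * t * (δ⁻¹ * (1 + A)) + 2 * t ^ 2 * C₁, by positivity, ?_⟩
  have hlarge : ∀ᶠ N : ℕ+ in atTop, m₁ + m₂ < (N : ℕ) :=
    tendsto_PNat_val_atTop_atTop.eventually_gt_atTop _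
  filter_upwards [hlarge, eventually_swapRatio h₁ (by linarith) hρ] with N hN hsw
  intro W v ℓ hW hWL hℓ1 hW0 hW1
  obtain ⟨hprob, hst, -⟩ := (h₁ ρ hρ).1 N
  set μ := S.ν ρ N with hμ
  set y : ℝ := (N : ℝ) with hy
  have hy1 : 1 ≤ y := by
    rw [hy]
    exact_mod_cast N.pos
  have hy0 : 0 < y := by linarith
  have hℓ0 : 0 ≤ ℓ := by
    have : 0 ≤ ℓ * y := (Finset.sum_nonneg fun _ _ => abs_nonneg _).trans hWL
    exact nonneg_of_mul_nonneg_left this hy0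
  set V : ℝ := (1 / y) * ∑ x, v x ^ 2 with hV
  have hV0 : 0 ≤ V := mul_nonneg (by positivity) (Finset.sum_nonneg fun _ _ => sq_nonneg _)
  have hVy : ∑ x, v x ^ 2 = y * V := by
    rw [hV]
    field_simp
  set e : ℝ := y ^ (-(2 / 3) : ℝ) with he
  have he0 : 0 ≤ e := Real.rpow_nonneg hy0.le _
  have hpow : ∀ (a : ℝ) (k : ℕ), y ^ a * y ^ k = y ^ (a + k) := fun a k => by
    rw [Real.rpow_add hy0, Real.rpow_natCast]
  have hsq : ∀ a : ℝ, (y ^ a) ^ 2 = y ^ (a * 2) := fun a => by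
    rw [← Real.rpow_natCast, ← Real.rpow_mul hy0.le]
    norm_num
  have hκ : A * y ^ (-β) * y ≤ A := by
    have : y ^ (-β) * y ≤ 1 := by
      have := hpow (-β) 1
      rw [pow_one] at this
      rw [this]
      exact Real.rpow_le_one_of_one_le_of_nonpos hy1 (by push_cast; linarith)
    nlinarith
  have hdr := (hcorr N).integral_sq_drift_le hN le_rfl (hcK N) (hpoly N) hW hWL v
  rw [hVy] at hdr
  have horder := drift_order_le (y := y) (ν := y ^ (-α)) (κ := A * y ^ (-β))
    (r := K * y ^ (-(2 * α))) (c := c N ∅) (B := K) (A := A) (D := 4 ^ (m₁ + m₂ + 1)) (ℓ := ℓ)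
    (V := V) (e := e) hy0.le hV0 hℓ0 hℓ1 hA (by positivity) (by positivity) he0 ?_ ?_ ?_ ?_
    (by linarith) (a := 5 * (m₁ + m₂ + 1) ^ 2) (b := 4 ^ M) (by positivity) (by positivity)
  · have hmain := (hX N).timeMoment_gradField_le hst (hcorr N) (by omega) hsw.1 hsw.2 hδ (hD N)
      hW hWL hW0 hW1 v ht
    rw [hVy] at hmain
    refine hmain.trans ?_
    have p1 : 4 * t * (δ⁻¹ * ((1 + y * (A * y ^ (-β))) * (ℓ * y * (y * V)))) / y ^ 2 ≤
        4 * t * (δ⁻¹ * (1 + A)) * V * (ℓ + e) := by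
      have : 4 * t * (δ⁻¹ * ((1 + y * (A * y ^ (-β))) * (ℓ * y * (y * V)))) / y ^ 2 =
          4 * t * (δ⁻¹ * (1 + A * y ^ (-β) * y)) * V * ℓ := by
        field_simp
      rw [this]
      gcongr
      linarith
    have p2 : 2 * t ^ 2 * ∫ η, drift μ v W η ^ 2 ∂μ ≤ 2 * t ^ 2 * (C₁ * V * (ℓ + e)) := by
      gcongr
      exact hdr.trans horder
    calc _ ≤ 4 * t * (δ⁻¹ * (1 + A)) * V * (ℓ + e) + 2 * t ^ 2 * (C₁ * V * (ℓ + e)) :=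
          add_le_add p1 p2
      _ = _ := by ring
  -- `2 - 2 α ≤ -2 / 3` because `α ≥ 4 / 3`
  · rw [hsq, hpow]
    exact Real.rpow_le_rpow_of_exponent_le hy1 (by push_cast; linarith)
  -- `4 - 2 α - β ≤ 0`
  · have : (y ^ (-α)) ^ 2 * (A * y ^ (-β)) * y ^ 4 = A * (y ^ (-α * 2) * (y ^ (-β) * y ^ 4)) := by
      rw [hsq]
      ring
    rw [this, hpow, ← Real.rpow_add hy0]
    exact mul_le_of_le_one_right hA
      (Real.rpow_le_one_of_one_le_of_nonpos hy1 (by push_cast; linarith))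
  · rw [mul_pow, mul_assoc, hsq, hpow]
    exact mul_le_mul_of_nonneg_left
      (Real.rpow_le_rpow_of_exponent_le hy1 (by push_cast; linarith)) (sq_nonneg _)
  · rcases hconst with h0 | h0
    · rw [h0 N]
      simp [sq_nonneg]
    -- the constant term requires `3 - 2 α ≤ 0`
    · have h6 : (y ^ (-α)) ^ 2 * y ^ 3 ≤ 1 := by
        rw [hsq, hpow]
        exact Real.rpow_le_one_of_one_le_of_nonpos hy1 (by push_cast; linarith)
      have h7 : c N ∅ ^ 2 ≤ K ^ 2 := by
        rw [← sq_abs]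
        exact pow_le_pow_left₀ (abs_nonneg _) (hcK N ∅) 2
      calc _ = c N ∅ ^ 2 * ((y ^ (-α)) ^ 2 * y ^ 3) := by ring
        _ ≤ K ^ 2 * 1 := by gcongr
        _ = K ^ 2 := mul_one _

end BoltzmannGibbs

/-! ### Replacement of the local product by block averages -/

namespace BoltzmannGibbs

/-- The weight function on `ZMod n` which puts the mass `w i` at the site `s i`, for `i < L`. -/
def siteWeight {n : ℕ} (L : ℕ) (s : ℕ → ZMod n) (w : ℕ → ℝ) (k : ZMod n) : ℝ :=
  ∑ i ∈ Finset.range L, if s i = k then w i else 0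

section

variable {n : ℕ} {L : ℕ} {s : ℕ → ZMod n} {w : ℕ → ℝ}

theorem siteWeight_eq_zero {k : ZMod n} (h : ∀ i < L, s i ≠ k) : siteWeight L s w k = 0 :=
  Finset.sum_eq_zero fun i hi => if_neg (h i (Finset.mem_range.1 hi))

theorem abs_siteWeight_le (hs : ∀ i < L, ∀ j < L, s i = s j → i = j) (hw : ∀ i < L, |w i| ≤ 1)
    (k : ZMod n) : |siteWeight L s w k| ≤ 1 := by
  by_cases h : ∃ i < L, s i = k
  · obtain ⟨i, hi, rfl⟩ := h
    rw [siteWeight, Finset.sum_eq_single_of_mem i (Finset.mem_range.2 hi), if_pos rfl]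
    · exact hw i hi
    · intro j hj hji
      exact if_neg fun h => hji (hs j (Finset.mem_range.1 hj) i hi h)
  · push Not at h
    rw [siteWeight_eq_zero h]
    simp

variable [NeZero n]

theorem sum_siteWeight_mul (g : ZMod n → ℝ) :
    ∑ k, siteWeight L s w k * g k = ∑ i ∈ Finset.range L, w i * g (s i) := by
  simp only [siteWeight, Finset.sum_mul]
  rw [Finset.sum_comm]
  refine Finset.sum_congr rfl fun i _ => ?_
  simp [ite_mul]

theorem sum_abs_siteWeight_le (hw : ∀ i < L, |w i| ≤ 1) : ∑ k, |siteWeight L s w k| ≤ L := by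
  calc ∑ k, |siteWeight L s w k|
      ≤ ∑ k, ∑ i ∈ Finset.range L, if s i = k then |w i| else 0 := by
        refine Finset.sum_le_sum fun k _ => (Finset.abs_sum_le_sum_abs _ _).trans ?_
        refine Finset.sum_le_sum fun i _ => ?_
        split_ifs <;> simp
    _ = ∑ i ∈ Finset.range L, |w i| := by
        rw [Finset.sum_comm]
        simp
    _ ≤ ∑ _i ∈ Finset.range L, (1 : ℝ) :=
        Finset.sum_le_sum fun i hi => hw i (Finset.mem_range.1 hi)
    _ = L := by simp

end

/-- Abel summation: the difference between a term and the average of the next `L` terms. -/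
theorem sub_average_succ (u : ℕ → ℝ) {L : ℕ} (hL : 0 < L) :
    u 0 - (1 / (L : ℝ)) * ∑ i ∈ Finset.range L, u (i + 1) =
      ∑ i ∈ Finset.range L, ((L - i : ℝ) / L) * (u i - u (i + 1)) := by
  have h : ∀ L : ℕ, (L : ℝ) * u 0 - ∑ i ∈ Finset.range L, u (i + 1) =
      ∑ i ∈ Finset.range L, (L - i : ℝ) * (u i - u (i + 1)) := by
    intro L
    induction L with
    | zero => simp
    | succ L ih =>
      have h1 : ∑ i ∈ Finset.range (L + 1), (((L + 1 : ℕ) : ℝ) - i) * (u i - u (i + 1)) =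
          ∑ i ∈ Finset.range (L + 1), ((L : ℝ) - i) * (u i - u (i + 1)) +
            ∑ i ∈ Finset.range (L + 1), (u i - u (i + 1)) := by
        rw [← Finset.sum_add_distrib]
        refine Finset.sum_congr rfl fun i _ => ?_
        push_cast
        ring
      rw [h1, Finset.sum_range_sub', Finset.sum_range_succ (fun i => ((L : ℝ) - i) * _), ← ih,
        Finset.sum_range_succ]
      push_cast
      ring
  have hL' : (L : ℝ) ≠ 0 := Nat.cast_ne_zero.2 hL.ne'
  simp only [div_mul_eq_mul_div]
  rw [← Finset.sum_div, ← h L]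
  field_simp

/-- Abel summation: the difference between a term and the average of `L` terms starting with it. -/
theorem sub_average (u : ℕ → ℝ) {L : ℕ} (hL : 0 < L) :
    u 0 - (1 / (L : ℝ)) * ∑ i ∈ Finset.range L, u i =
      ∑ i ∈ Finset.range L, ((L - i - 1 : ℝ) / L) * (u i - u (i + 1)) := by
  have h1 : ∑ i ∈ Finset.range L, ((L - i - 1 : ℝ) / L) * (u i - u (i + 1)) =
      ∑ i ∈ Finset.range L, ((L - i : ℝ) / L) * (u i - u (i + 1)) -
        (1 / (L : ℝ)) * ∑ i ∈ Finset.range L, (u i - u (i + 1)) := by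
    rw [Finset.mul_sum, ← Finset.sum_sub_distrib]
    refine Finset.sum_congr rfl fun i _ => ?_
    ring
  rw [h1, ← sub_average_succ u hL, Finset.sum_sub_distrib]
  ring

theorem natCast_zmod_ne_zero {n m : ℕ} (h0 : 0 < m) (h1 : m < n) : (m : ZMod n) ≠ 0 := by
  rw [Ne, ZMod.natCast_eq_zero_iff]
  exact Nat.not_dvd_of_pos_of_lt h0 h1

theorem natCast_zmod_inj {n i j : ℕ} (hi : i < n) (hj : j < n)
    (h : (i : ZMod n) = (j : ZMod n)) : i = j := by
  rwa [ZMod.natCast_eq_natCast_iff', Nat.mod_eq_of_lt hi, Nat.mod_eq_of_lt hj] at h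

/-- The weights of the gradients in `η̄_{x+1} - →η_x`. -/
noncomputable def rightWeight (n L : ℕ) : ZMod n → ℝ :=
  siteWeight L (fun i => ((i + 1 : ℕ) : ZMod n)) fun i => (L - i - 1 : ℝ) / L

/-- The weights of the gradients in `η̄_x - ←η_x`, as seen from the site `x + a`. -/
noncomputable def leftWeight (n L a : ℕ) : ZMod n → ℝ :=
  siteWeight L (fun i => -((a + i + 1 : ℕ) : ZMod n)) fun i => -((L - i : ℝ) / L)

theorem abs_right_coeff_le {L i : ℕ} (hi : i < L) : |(L - i - 1 : ℝ) / L| ≤ 1 := by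
  have h : (i : ℝ) + 1 ≤ L := by exact_mod_cast hi
  have hi0 : (0 : ℝ) ≤ i := Nat.cast_nonneg _
  rw [abs_of_nonneg (div_nonneg (by linarith) (by linarith)), div_le_one (by linarith)]
  linarith

theorem abs_left_coeff_le {L i : ℕ} (hi : i < L) : |-((L - i : ℝ) / L)| ≤ 1 := by
  have h : (i : ℝ) + 1 ≤ L := by exact_mod_cast hi
  have hi0 : (0 : ℝ) ≤ i := Nat.cast_nonneg _
  rw [abs_neg, abs_of_nonneg (div_nonneg (by linarith) (by linarith)), div_le_one (by linarith)]
  linarith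

/-- The left particle is replaced only after the right one, whose block average is written out as an
average over `a`: every summand is a `gradField` with the swaps away from the other particle. -/
theorem field_eq {N : ℕ+} (μ : Measure (Config N)) (G : UnitAddCircle → ℝ) {L : ℕ} (hL : 0 < L)
    (η : Config N) :
    field μ G L η = gradField μ (fun x => G (toCircle x)) (rightWeight N L) η +
      (1 / (L : ℝ)) * ∑ a ∈ Finset.Icc 1 L,
        gradField μ (fun x => G (toCircle (x - (a : ZMod N)))) (leftWeight N L a) η := by
  have hIcc : ∀ g : ℕ → ℝ, ∑ y ∈ Finset.Icc 1 L, g y = ∑ i ∈ Finset.range L, g (i + 1) := by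
    intro g
    rw [Finset.range_eq_Ico, Finset.sum_Ico_add' g 0 L 1]
    rfl
  have hright : ∀ x : ZMod N, ∑ k, rightWeight N L k * grad μ η (x + k) =
      cent μ η (x + 1) - rightAvg μ L η x := by
    intro x
    have h := sub_average (fun i => cent μ η (x + ((i + 1 : ℕ) : ZMod N))) hL
    rw [rightWeight, sum_siteWeight_mul (fun k => grad μ η (x + k)), rightAvg, hIcc]
    simp only [zero_add, Nat.cast_one] at h
    rw [h]
    refine Finset.sum_congr rfl fun i _ => ?_
    simp only [grad]
    push_cast
    ring_nf
  have hleft : ∀ (x : ZMod N) (a : ℕ),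
      ∑ k, leftWeight N L a k * grad μ η (x + (a : ZMod N) + k) =
        cent μ η x - leftAvg μ L η x := by
    intro x a
    have h := sub_average_succ (fun i => cent μ η (x - (i : ZMod N))) hL
    rw [leftWeight, sum_siteWeight_mul (fun k => grad μ η (x + (a : ZMod N) + k)), leftAvg, hIcc]
    simp only [Nat.cast_zero, sub_zero] at h
    rw [h]
    refine Finset.sum_congr rfl fun i _ => ?_
    simp only [grad]
    have e1 : x + (a : ZMod N) + -((a + i + 1 : ℕ) : ZMod N) = x - ((i + 1 : ℕ) : ZMod N) := by
      push_cast
      ring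
    have e2 : x - ((i + 1 : ℕ) : ZMod N) + 1 = x - (i : ZMod N) := by
      push_cast
      ring
    rw [e1, e2]
    ring
  have hgl : ∀ a : ℕ, gradField μ (fun x => G (toCircle (x - (a : ZMod N)))) (leftWeight N L a) η =
      ∑ x, G (toCircle x) * (cent μ η (x + (a : ZMod N)) * (cent μ η x - leftAvg μ L η x)) := by
    intro a
    refine (Fintype.sum_equiv (Equiv.addRight (a : ZMod N)) _ _ fun x => ?_).symm
    simp only [Equiv.coe_addRight, add_sub_cancel_right, hleft]
  simp only [hgl]
  rw [Finset.sum_comm, Finset.mul_sum, gradField, ← Finset.sum_add_distrib]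
  refine Finset.sum_congr rfl fun x _ => ?_
  rw [hright, ← Finset.mul_sum, ← Finset.sum_mul]
  simp only [rightAvg]
  ring

/-- The replacement error for a fixed macroscopic size of the boxes. -/
theorem exists_replacementError_le {S : ParticleSystem} {α β : ℝ}
    (h₁ : NearlySwapInvariant S α) (h₂ : CorrelationDecay S β) (h₃ : SwapDirichletForm S)
    {ρ : ℝ} (hρ : ρ ∈ S.I) {Ω : ℕ+ → Type*} [∀ N, MeasurableSpace (Ω N)]
    {P : ∀ N : ℕ+, Measure (Ω N)} {X : ∀ N : ℕ+, ℝ → Ω N → Config N}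
    (hX : ∀ N : ℕ+, IsMarkovProcess S N (S.ν ρ N) (P N) (X N)) {t : ℝ} (ht : 0 ≤ t)
    {G : UnitAddCircle → ℝ} (hG : BddAbove (Set.range fun N : ℕ+ => normSqN G N))
    {m₁ m₂ : ℕ} {c : ℕ+ → Finset ℤ → ℝ} {K : ℝ} (hc : GradExpansion S α ρ m₁ m₂ c K)
    (hα : 4 / 3 ≤ α) (hβ : 1 ≤ β) (hαβ : 4 ≤ 2 * α + β)
    (hconst : (∀ N, c N ∅ = 0) ∨ 3 / 2 ≤ α) :
    ∃ C : ℝ, ∀ ε : ℝ, 0 < ε → ε < 1 / 2 → ∀ᶠ N : ℕ+ in atTop,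
      replacementError (S.ν ρ N) (P N) (X N) G t ε ≤ ENNReal.ofReal (C * ε) := by
  obtain ⟨C, hC, hev⟩ := exists_timeMoment_gradField_le h₁ h₂ h₃ hρ hX ht hc hα hβ hαβ hconst
  obtain ⟨V, hV⟩ := hG
  have hV' : ∀ N : ℕ+, normSqN G N ≤ V := fun N => hV ⟨N, rfl⟩
  have hV0 : 0 ≤ V := by
    refine le_trans ?_ (hV' 1)
    unfold normSqN
    exact mul_nonneg (by positivity) (Finset.sum_nonneg fun _ _ => sq_nonneg _)
  refine ⟨8 * (C * V), fun ε hε hε2 => ?_⟩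
  have hNlim : Tendsto (fun N : ℕ+ => ε * (N : ℝ)) atTop atTop :=
    (tendsto_natCast_atTop_atTop.comp tendsto_PNat_val_atTop_atTop).const_mul_atTop hε
  have hsmall := (tendsto_pnat_rpow_neg (show (0 : ℝ) < 2 / 3 by norm_num)).eventually
    (gt_mem_nhds hε)
  filter_upwards [hev, hNlim.eventually_ge_atTop 1, hsmall] with N hN hN1 hNε
  have hy : (0 : ℝ) < N := Nat.cast_pos.2 N.pos
  set L := ⌊ε * (N : ℝ)⌋₊ with hL
  have hL0 : 0 < L := Nat.floor_pos.2 hN1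
  have hLε : (L : ℝ) ≤ ε * N := Nat.floor_le (by positivity)
  have hLN : 2 * L < (N : ℕ) := by
    have : (2 : ℝ) * L < N := by nlinarith
    exact_mod_cast this
  have hT : 0 ≤ t * (N : ℝ) ^ 2 := by positivity
  set B := (N : ℝ) ^ 4 * (C * V * (2 * ε)) with hB
  -- the common bound for all the gradient fields
  have hbound : ∀ (W v : ZMod N → ℝ), (∀ k, |W k| ≤ 1) → ∑ k, |W k| ≤ L → W 0 = 0 → W (-1) = 0 →
      ∑ x, v x ^ 2 = ∑ x : ZMod N, G (toCircle x) ^ 2 →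
      timeMoment (P N) (X N) (t * (N : ℝ) ^ 2) (gradField (S.ν ρ N) v W) ≤ B := by
    intro W v hW hWL hW0 hW1 hv
    have h := hN W v ε hW (hWL.trans hLε) (by linarith) hW0 hW1
    rw [hv, inv_mul_le_iff₀ (by positivity)] at h
    refine h.trans (mul_le_mul_of_nonneg_left ?_ (by positivity))
    have := hV' N
    unfold normSqN at this
    gcongr
    linarith
  have hfirst : timeMoment (P N) (X N) (t * (N : ℝ) ^ 2)
      (gradField (S.ν ρ N) (fun x => G (toCircle x)) (rightWeight N L)) ≤ B := by
    refine hbound _ _ (abs_siteWeight_le ?_ fun i hi => abs_right_coeff_le hi)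
      (sum_abs_siteWeight_le fun i hi => abs_right_coeff_le hi) (siteWeight_eq_zero ?_)
      (siteWeight_eq_zero ?_) rfl
    · intro i hi j hj hij
      have := natCast_zmod_inj (by omega) (by omega) hij
      omega
    · intro i hi
      exact natCast_zmod_ne_zero (by omega) (by omega)
    · intro i hi h
      refine natCast_zmod_ne_zero (n := N) (m := i + 2) (by omega) (by omega) ?_
      push_cast at h ⊢
      linear_combination h
  have hsecond : ∀ a ∈ Finset.Icc 1 L, timeMoment (P N) (X N) (t * (N : ℝ) ^ 2)
      (gradField (S.ν ρ N) (fun x => G (toCircle (x - (a : ZMod N)))) (leftWeight N L a)) ≤ B := by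
    intro a ha
    rw [Finset.mem_Icc] at ha
    refine hbound _ _ (abs_siteWeight_le ?_ fun i hi => abs_left_coeff_le hi)
      (sum_abs_siteWeight_le fun i hi => abs_left_coeff_le hi) (siteWeight_eq_zero ?_)
      (siteWeight_eq_zero ?_) ?_
    · intro i hi j hj hij
      have := natCast_zmod_inj (by omega) (by omega) (neg_injective hij)
      omega
    · intro i hi h
      exact natCast_zmod_ne_zero (by omega) (by omega) (neg_eq_zero.1 h)
    · intro i hi h
      refine natCast_zmod_ne_zero (n := N) (m := a + i) (by omega) (by omega) ?_
      push_cast at h ⊢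
      linear_combination -h
    · exact Fintype.sum_equiv (Equiv.subRight (a : ZMod N)) _ _ fun x => rfl
  have hfield : timeMoment (P N) (X N) (t * (N : ℝ) ^ 2) (field (S.ν ρ N) G L) ≤ 4 * B := by
    have e : field (S.ν ρ N) G L = fun η => _ := funext fun η => field_eq (S.ν ρ N) G hL0 η
    rw [e]
    have h2 := (hX N).timeMoment_average_le hL0 (fun a => gradField (S.ν ρ N)
      (fun x => G (toCircle (x - (a : ZMod N)))) (leftWeight N L a)) hT hsecond
    have h3 := (hX N).timeMoment_add_le
      (gradField (S.ν ρ N) (fun x => G (toCircle x)) (rightWeight N L))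
      (fun η => (1 / (L : ℝ)) * ∑ a ∈ Finset.Icc 1 L, gradField (S.ν ρ N)
        (fun x => G (toCircle (x - (a : ZMod N)))) (leftWeight N L a) η) hT
    linarith
  rw [replacementError, (hX N).lintegral_sq_timeScale (field (S.ν ρ N) G L) ht]
  refine ENNReal.ofReal_le_ofReal ?_
  rw [inv_mul_le_iff₀ (by positivity)]
  refine hfield.trans (le_of_eq ?_)
  rw [hB]
  ring

theorem tendsto_limsup_replacementError {S : ParticleSystem} {α β : ℝ}
    (h₁ : NearlySwapInvariant S α) (h₂ : CorrelationDecay S β) (h₃ : SwapDirichletForm S)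
    {ρ : ℝ} (hρ : ρ ∈ S.I) {Ω : ℕ+ → Type*} [∀ N, MeasurableSpace (Ω N)]
    {P : ∀ N : ℕ+, Measure (Ω N)} {X : ∀ N : ℕ+, ℝ → Ω N → Config N}
    (hX : ∀ N : ℕ+, IsMarkovProcess S N (S.ν ρ N) (P N) (X N)) {t : ℝ} (ht : 0 ≤ t)
    {G : UnitAddCircle → ℝ} (hG : BddAbove (Set.range fun N : ℕ+ => normSqN G N))
    {m₁ m₂ : ℕ} {c : ℕ+ → Finset ℤ → ℝ} {K : ℝ} (hc : GradExpansion S α ρ m₁ m₂ c K)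
    (hα : 4 / 3 ≤ α) (hβ : 1 ≤ β) (hαβ : 4 ≤ 2 * α + β)
    (hconst : (∀ N, c N ∅ = 0) ∨ 3 / 2 ≤ α) :
    Tendsto (fun ε : ℝ => limsup
      (fun N : ℕ+ => replacementError (S.ν ρ N) (P N) (X N) G t ε) atTop) (𝓝[>] 0) (𝓝 0) := by
  obtain ⟨C, hC⟩ := exists_replacementError_le h₁ h₂ h₃ hρ hX ht hG hc hα hβ hαβ hconst
  have hlim : Tendsto (fun ε : ℝ => ENNReal.ofReal (C * ε)) (𝓝[>] 0) (𝓝 0) := by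
    have : Continuous fun ε : ℝ => ENNReal.ofReal (C * ε) :=
      ENNReal.continuous_ofReal.comp (continuous_const.mul continuous_id)
    have h := this.tendsto 0
    simp only [mul_zero, ENNReal.ofReal_zero] at h
    exact h.mono_left nhdsWithin_le_nhds
  refine tendsto_of_tendsto_of_tendsto_of_le_of_le' tendsto_const_nhds hlim
    (Eventually.of_forall fun _ => zero_le) ?_
  filter_upwards [Ioo_mem_nhdsGT (show (0 : ℝ) < 1 / 2 by norm_num)] with ε hε
  exact limsup_le_of_le (h := hC ε hε.1 hε.2)

end BoltzmannGibbs

theorem mainTheorem2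
    (S : BoltzmannGibbs.ParticleSystem) (α β : ℝ)
    (h₁ : BoltzmannGibbs.NearlySwapInvariant S α)
    (h₂ : BoltzmannGibbs.CorrelationDecay S β)
    (h₃ : BoltzmannGibbs.SwapDirichletForm S)
    (ρ : ℝ) (hρ : ρ ∈ S.I)
    {Ω : ℕ+ → Type*} [∀ N, MeasurableSpace (Ω N)] (P : ∀ N : ℕ+, Measure (Ω N))
    (X : ∀ N : ℕ+, ℝ → Ω N → BoltzmannGibbs.Config N)
    (hX : ∀ N : ℕ+, BoltzmannGibbs.IsMarkovProcess S N (S.ν ρ N) (P N) (X N))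
    (t : ℝ) (ht : 0 < t) (G : UnitAddCircle → ℝ)
    (hG : BddAbove (Set.range fun N : ℕ+ => BoltzmannGibbs.normSqN G N)) :
    (3 / 2 ≤ α → 1 ≤ β →
      Tendsto
        (fun ε : ℝ => limsup
          (fun N : ℕ+ => BoltzmannGibbs.replacementError (S.ν ρ N) (P N) (X N) G t ε) atTop)
        (𝓝[>] 0) (𝓝 0)) ∧
    (BoltzmannGibbs.NoConstantTerm S α → 4 / 3 ≤ α → 1 ≤ β → 4 ≤ 2 * α + β →
      Tendsto
        (fun ε : ℝ => limsup
          (fun N : ℕ+ => BoltzmannGibbs.replacementError (S.ν ρ N) (P N) (X N) G t ε) atTop)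
        (𝓝[>] 0) (𝓝 0)) := by
  refine ⟨fun hα hβ => ?_, fun hconst hα hβ hαβ => ?_⟩
  · obtain ⟨m₁, m₂, c, K, hc⟩ := h₁.exists_gradExpansion hρ
    exact BoltzmannGibbs.tendsto_limsup_replacementError h₁ h₂ h₃ hρ hX ht.le hG hc (by linarith)
      hβ (by linarith) (Or.inr hα)
  · obtain ⟨m₁, m₂, c, K, hc, h0⟩ := hconst.exists_gradExpansion hρ
    exact BoltzmannGibbs.tendsto_limsup_replacementError h₁ h₂ h₃ hρ hX ht.le hG hc hα hβ hαβ
      (Or.inl h0)
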